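/- **Model.** Let $X$ be an $m\times n$ matrix with entries in $\{0,1\}$. The rows are partitioned into $r$ row clusters of equal size $m_0$ and the columns into $t$ column clusters of equal size $n_0$. These partitions are deterministic. $X$ is constant on each product of a row cluster and a column cluster, and its values on the $rt$ products are i.i.d. Bernoulli$(1/2)$. The observation matrix $Y\in\{0,1,e\}^{m\times n}$ is obtained by passing every entry of $X$ independently through a binary symmetric channel with error probability $p$ and then through an erasure channel with erasure probability $\epsilon$ ($e$ denotes erasure). The partitions are unknown: an estimator $\hat X$ is a (possibly randomized) function of $Y$. Let $\bar P_e=\Pr(\hat X\ne X)$, averaged over $X$, the channel, and the randomness of the estimator. Put $p_1=\epsilon+2(1-\epsilon)\sqrt{p(1-p)}$, and read $\ln(mn)/\ln(1/p_1)$ as $0$ if $p_1=0$. **The estimator.** Fix $d_0$. For two rows $i,j$ let $N_{ij}$ be the number of columns in which both rows are unerased, and let $d_{ij}$ be the number of those columns in which $Y_{ik}\ne Y_{jk}$, divided by $N_{ij}$ ($d_{ij}=0$ if $N_{ij}=0$). The estimated cluster of row $i$ is $\{j: d_{ij}<d_0\}$. The estimated clusters of columns are defined in the same way. Then $\hat X_{ik}$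 is the majority value among the unerased entries of $Y$ in the product of the estimated clusters of row $i$ and of column $k$. A tie is broken by a bit attached to that product (to its first row and first column); the tie-breaking bits are independent of $X$ and $Y$ and have any law, for example independent fair coins. **Theorem.** Let $p_0<1/2$. Consider any sequence of such models with $mn\to\infty$ and with fixed $p\in[0,p_0]$ and $\epsilon\in[0,1)$. 1. *Converse.* If for some fixed $\delta>0$, for all large indices of the sequence, $$m_0n_0<(1-\delta)\frac{\ln(mn)}{\ln(1/p_1)},$$ then $\bar P_e\to1$ for every sequence of estimators. 2. *Achievability.* Let $p_0\ge 0$ and $d_0\in(2p_0(1-p_0),1/2)$. There is a constant $C>0$, depending only on $p_0$ and $d_0$, such that the following holds for all $p\in[0,p_0]$, all $\epsilon\in[0,1)$ and all sequences as above. If $t\ge C\ln n$ and $r\ge C\ln m$ for all large indices, $\limsup m/n<\infty$, $\limsup n/m<\infty$, and for all large indices $$m_0n_0>\frac{\ln(mn)}{\ln(1/p_1)},$$ then $\bar P_e\to0$ for the above estimator with threshold $d_0$. This estimator does not depend on $p,\epsilon,m_0,n_0$ or on the clusters. It runs in polynomial time: there are a single program of a unit-cost random access machine (with addition and subtraction of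 natural numbers, comparisons, indexed memory access, and comparison of a ratio of two counters with the threshold $d_0$) and a polynomial $q$, both independent of $d_0$, such that the program computes $\hat X$ from $m$, $n$, $Y$ and the tie-breaking bits in at most $q(m+n)$ steps. -/

import Mathlib

open Filter Topology
open scoped ENNReal

/-- Block structure of a rating matrix: `m` rows and `n` columns are partitioned into `r` row
clusters of equal size `m₀` and `t` column clusters of equal size `n₀` (the fibres of `row` and
`col`). As `m` and `n` are positive, so are `r`, `t`, `m₀` and `n₀`, and no cluster is empty. -/
structure BlockModel where
  m : ℕ
  n : ℕ
  r : ℕ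
  t : ℕ
  m₀ : ℕ
  n₀ : ℕ
  m_pos : 0 < m
  n_pos : 0 < n
  row : Fin m → Fin r
  col : Fin n → Fin t
  card_row : ∀ a, (Finset.univ.filter fun i => row i = a).card = m₀
  card_col : ∀ b, (Finset.univ.filter fun k => col k = b).card = n₀

/-- Binary rating matrices. -/
abbrev Ratings (m n : ℕ) : Type := Fin m → Fin n → Bool

/-- Observation matrices over `{0, 1, e}`; the erasure symbol `e` is `none`. -/
abbrev Observations (m n : ℕ) : Type := Fin m → Fin n → Option Bool

/-- The block constant matrix with value `w a b` on the cluster `(a, b)`. -/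
def BlockModel.expand (M : BlockModel) (w : Fin M.r → Fin M.t → Bool) : Ratings M.m M.n :=
  fun i k => w (M.row i) (M.col k)

/-- Transition probabilities of the binary symmetric channel with error probability `p`. -/
def bsc (p : ℝ) (x z : Bool) : ℝ := if z = x then 1 - p else p

/-- Transition probabilities of the erasure channel with erasure probability `ε`. -/
def erasureChannel (ε : ℝ) (z : Bool) : Option Bool → ℝ
  | none => ε
  | some y => if y = z then 1 - ε else 0

/-- The cascade: first the binary symmetric channel, then the erasure channel. -/
def cascade (p ε : ℝ) (x : Bool) (y : Option Bool) : ℝ :=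
  ∑ z : Bool, bsc p x z * erasureChannel ε z y

/-- `Pr(Y = y | X = x)`; the channel is memoryless over the entries. -/
def obsProb (p ε : ℝ) {m n : ℕ} (x : Ratings m n) (y : Observations m n) : ℝ :=
  ∏ i : Fin m, ∏ k : Fin n, cascade p ε (x i k) (y i k)

/-- A (possibly randomised) estimator of the rating matrix from the observations. -/
abbrev Estimator (m n : ℕ) : Type := Observations m n → PMF (Ratings m n)

/-- The average block error probability `Pr(X̂ ≠ X)`: the cluster values are i.i.d. Bernoulli(1/2),
`Y` is the channel output, and `X̂` is drawn from the law that the estimator assigns to `Y`. -/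
noncomputable def BlockModel.avgError (M : BlockModel) (p ε : ℝ) (g : Estimator M.m M.n) : ℝ :=
  ∑ w : Fin M.r → Fin M.t → Bool, (1 / 2 : ℝ) ^ (M.r * M.t) *
    ∑ y : Observations M.m M.n, obsProb p ε (M.expand w) y *
      ∑ x' ∈ Finset.univ.filter (fun x' : Ratings M.m M.n => x' ≠ M.expand w), (g y x').toReal

/-- `p₁ = ε + 2 (1 - ε) √(p (1 - p))`. -/
noncomputable def p1 (p ε : ℝ) : ℝ := ε + 2 * (1 - ε) * √(p * (1 - p))

/-! ### Threshold clustering and majority decoding -/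

/-- Number of positions that are unerased in both vectors. -/
def commonCount {ι : Type} [Fintype ι] (u v : ι → Option Bool) : ℕ :=
  (Finset.univ.filter fun k => u k ≠ none ∧ v k ≠ none).card

/-- Number of positions that are unerased in both vectors and where they differ. -/
def disagreeCount {ι : Type} [Fintype ι] (u v : ι → Option Bool) : ℕ :=
  (Finset.univ.filter fun k => u k ≠ none ∧ v k ≠ none ∧ u k ≠ v k).card

/-- Normalised Hamming distance over the commonly sampled positions (`0` if there are none). -/
noncomputable def hammingRatio {ι : Type} [Fintype ι] (u v : ι → Option Bool) : ℝ :=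
  (disagreeCount u v : ℝ) / (commonCount u v : ℝ)

open Classical in
/-- The estimated cluster of row `i` of `y`: the rows whose normalised Hamming distance to row `i`
is less than `d₀`. -/
noncomputable def estCluster {m n : ℕ} (d₀ : ℝ) (y : Observations m n) (i : Fin m) :
    Finset (Fin m) :=
  Finset.univ.filter fun j => hammingRatio (y i) (y j) < d₀

/-- First element of the estimated cluster of row `i` (and `i` itself if that set is empty). -/
noncomputable def estRep {m n : ℕ} (d₀ : ℝ) (y : Observations m n) (i : Fin m) : Fin m :=
  (estCluster d₀ y i).min.untopD i

/-- Exchange of rows and columns. -/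
def flipObs {m n : ℕ} (y : Observations m n) : Observations n m := fun k i => y i k

/-- Number of observations with value `b` in the estimated cluster of the entry `(i, k)`, that is,
the product of the estimated clusters of row `i` and of column `k`. -/
noncomputable def votes {m n : ℕ} (d₀ : ℝ) (y : Observations m n) (i : Fin m) (k : Fin n)
    (b : Bool) : ℕ :=
  ((estCluster d₀ y i ×ˢ estCluster d₀ (flipObs y) k).filter fun q => y q.1 q.2 = some b).card

/-- Cluster rows and columns by thresholding at `d₀`, then decode every entry by majority in its
estimated cluster. A tie is broken by the bit of `τ` attached to the estimated cluster (at the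
position of its first row and first column). -/
noncomputable def clusterMajority {m n : ℕ} (d₀ : ℝ) (τ : Fin m → Fin n → Bool)
    (y : Observations m n) : Ratings m n := fun i k =>
  if votes d₀ y i k true < votes d₀ y i k false then false
  else if votes d₀ y i k false < votes d₀ y i k true then true
  else τ (estRep d₀ y i) (estRep d₀ (flipObs y) k)

/-- The estimator `clusterMajority` when the tie-breaking bits have law `κ` (uniform for
independent fair coins) and are independent of everything else. -/
noncomputable def clusterMajorityEstimator {m n : ℕ} (d₀ : ℝ) (κ : PMF (Fin m → Fin n → Bool)) :
    Estimator m n :=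
  fun y => κ.map fun τ => clusterMajority d₀ τ y

/-! ### A random access machine with a step count -/

/-- Memory: registers, and two-dimensional arrays `arr a i j`, all holding natural numbers. -/
structure RamState where
  reg : ℕ → ℕ
  arr : ℕ → ℕ → ℕ → ℕ

def RamState.setReg (s : RamState) (x v : ℕ) : RamState :=
  { s with reg := Function.update s.reg x v }

def RamState.setArr (s : RamState) (a i j v : ℕ) : RamState :=
  { s with arr := fun a' i' j' => if a' = a ∧ i' = i ∧ j' = j then v else s.arr a' i' j' }

/-- Programs. The arguments `x y z i` are register names, `a` is an array name, `c` a constant. -/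
inductive RamProg where
  | skip
  /-- `x := c` -/
  | const (x c : ℕ)
  /-- `x := y + z` -/
  | add (x y z : ℕ)
  /-- `x := y - z`, and `0` if `y < z` -/
  | sub (x y z : ℕ)
  /-- `x := a[y, z]` -/
  | load (x a y z : ℕ)
  /-- `a[y, z] := x` -/
  | store (a y z x : ℕ)
  | seq (P Q : RamProg)
  /-- if `x = y` then `P` else `Q` -/
  | ifEq (x y : ℕ) (P Q : RamProg)
  /-- if `x < y` then `P` else `Q` -/
  | ifLt (x y : ℕ) (P Q : RamProg)
  /-- if the ratio `x / y` is below the given threshold then `P` else `Q` -/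
  | ifBelow (x y : ℕ) (P Q : RamProg)
  /-- for `i = 0, 1, …, x - 1` do `P`, where `x` is read once, at the start -/
  | loop (i x : ℕ) (P : RamProg)

/-- Final state and number of steps. Every assignment, every test and every loop round costs one
step; `below` is the comparison of a ratio with the threshold. -/
def RamProg.run (below : ℕ → ℕ → Bool) : RamProg → RamState → RamState × ℕ
  | .skip, s => (s, 1)
  | .const x c, s => (s.setReg x c, 1)
  | .add x y z, s => (s.setReg x (s.reg y + s.reg z), 1)
  | .sub x y z, s => (s.setReg x (s.reg y - s.reg z), 1)
  | .load x a y z, s => (s.setReg x (s.arr a (s.reg y) (s.reg z)), 1)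
  | .store a y z x, s => (s.setArr a (s.reg y) (s.reg z) (s.reg x), 1)
  | .seq P Q, s =>
    ((Q.run below (P.run below s).1).1, (P.run below s).2 + (Q.run below (P.run below s).1).2)
  | .ifEq x y P Q, s =>
    if s.reg x = s.reg y then ((P.run below s).1, (P.run below s).2 + 1)
    else ((Q.run below s).1, (Q.run below s).2 + 1)
  | .ifLt x y P Q, s =>
    if s.reg x < s.reg y then ((P.run below s).1, (P.run below s).2 + 1)
    else ((Q.run below s).1, (Q.run below s).2 + 1)
  | .ifBelow x y P Q, s =>
    if below (s.reg x) (s.reg y) then ((P.run below s).1, (P.run below s).2 + 1)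
    else ((Q.run below s).1, (Q.run below s).2 + 1)
  | .loop i x P, s =>
    Nat.rec (s, 1)
      (fun j acc =>
        ((P.run below (acc.1.setReg i j)).1, acc.2 + (P.run below (acc.1.setReg i j)).2 + 1))
      (s.reg x)

/-- The comparison `a / b < d₀` of a ratio (`0` if `b = 0`) with the real threshold `d₀`. -/
noncomputable def belowThreshold (d₀ : ℝ) (a b : ℕ) : Bool :=
  open Classical in decide ((a : ℝ) / (b : ℝ) < d₀)

/-- Symbols as numbers: the ratings are `0` and `1`, an erasure is `2`. -/
def symbolCode : Option Bool → ℕ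
  | some false => 0
  | some true => 1
  | none => 2

/-- Initial memory: `m` and `n` in registers `0` and `1`, the observations in array `0`, the
tie-breaking bits in array `1`, and `0` everywhere else. -/
def ramInput {m n : ℕ} (τ : Fin m → Fin n → Bool) (y : Observations m n) : RamState where
  reg x := if x = 0 then m else if x = 1 then n else 0
  arr a i j :=
    if h : i < m ∧ j < n then
      if a = 0 then symbolCode (y ⟨i, h.1⟩ ⟨j, h.2⟩)
      else if a = 1 then symbolCode (some (τ ⟨i, h.1⟩ ⟨j, h.2⟩))
      else 0
    else 0

/-- On every input of every size `m × n` the program `P` with threshold `d₀` halts after at most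
`q (m + n)` steps with the matrix `clusterMajority d₀ τ y` in array `2`. -/
def RunsWithin (d₀ : ℝ) (P : RamProg) (q : Polynomial ℕ) : Prop :=
  ∀ (m n : ℕ) (τ : Fin m → Fin n → Bool) (y : Observations m n),
    (P.run (belowThreshold d₀) (ramInput τ y)).2 ≤ q.eval (m + n) ∧
    ∀ (i : Fin m) (k : Fin n),
      (P.run (belowThreshold d₀) (ramInput τ y)).1.arr 2 i k =
        symbolCode (some (clusterMajority d₀ τ y i k))

/-! Write N = m₀n₀, I = ln(1/p₁) and L = ln(mn), so that there are rt = mn/N clusters of N entries.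
The number p₁ is the Bhattacharyya coefficient of the two output laws of one entry
(`sum_sqrt_cascade`), hence p₁^N is that of a whole cluster. It governs the error of deciding one
bit from N observations, and the threshold N = L/I is where p₁^N equals 1/(mn).

Converse: the bound holds even for estimators that use the partitions. For known partitions the
clusters are independent binary tests, and the success probability is at most the product over
clusters of ½∑max(P₁, P₀) = 1 - ½∑min(P₁, P₀), where P₁ and P₀ are the two laws of the observations
of the cluster (`one_sub_avgError_le`). If every overlap ∑min is at least q, this is at most
exp(-q·rt/2) (`one_sub_avgError_le_exp`). A change of measure to the normalised geometric mean of P₁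
and P₀ turns the log-likelihood ratio into a centred random walk, so q may be taken as p₁^N
exp(-b√N) (`exists_le_sum_min`). Below the threshold by a factor 1 - δ, q·rt still grows like a
power of mn up to a factor 1/L.

Achievability: a union bound over three kinds of failure. For two rows, disagreements minus d₀ times
common columns is a sum of independent bounded scores. Its mean is negative for rows of one cluster,
because 2p(1-p) < d₀, and positive for rows of different clusters whose values differ in nearly half
of the column clusters, because d₀ < 1/2. An exponential tail bound (`massOf_two_rows_le`) controls
both cases, and also the chance that two rows of cluster values differ too rarely. It is the latter
that requires t ≥ C ln n. Columns are the rows of the transposed model. If all clusters are right, a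
tie or a wrong majority in a given cluster has probability at most p₁^N < 1/(mn)
(`massOf_majority_le`), and rt of these add up to at most 1/N, which tends to zero.

Running time: an explicit program is verified with loop invariants. All its loop bounds are m or n,
held in registers that are never written, so its cost is bounded by a polynomial read off from its
syntax (`run_cost_le`). -/

/-! ### Programs: frames, cost, loop invariants -/

namespace RamProg

/-- The registers that a program may write. -/
def regs : RamProg → List ℕ
  | .skip => []
  | .const x _ => [x]
  | .add x _ _ => [x]
  | .sub x _ _ => [x]
  | .load x _ _ _ => [x]
  | .store _ _ _ _ => []
  | .seq P Q => P.regs ++ Q.regs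
  | .ifEq _ _ P Q => P.regs ++ Q.regs
  | .ifLt _ _ P Q => P.regs ++ Q.regs
  | .ifBelow _ _ P Q => P.regs ++ Q.regs
  | .loop i _ P => i :: P.regs

/-- The arrays that a program may write. -/
def arrs : RamProg → List ℕ
  | .store a _ _ _ => [a]
  | .seq P Q => P.arrs ++ Q.arrs
  | .ifEq _ _ P Q => P.arrs ++ Q.arrs
  | .ifLt _ _ P Q => P.arrs ++ Q.arrs
  | .ifBelow _ _ P Q => P.arrs ++ Q.arrs
  | .loop _ _ P => P.arrs
  | _ => []

/-- The registers that hold the number of rounds of a loop. -/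
def bounds : RamProg → List ℕ
  | .seq P Q => P.bounds ++ Q.bounds
  | .ifEq _ _ P Q => P.bounds ++ Q.bounds
  | .ifLt _ _ P Q => P.bounds ++ Q.bounds
  | .ifBelow _ _ P Q => P.bounds ++ Q.bounds
  | .loop _ x P => x :: P.bounds
  | _ => []

/-- A bound for the number of steps when every loop has at most `X` rounds. -/
noncomputable def costPoly : RamProg → Polynomial ℕ
  | .seq P Q => P.costPoly + Q.costPoly
  | .ifEq _ _ P Q => P.costPoly + Q.costPoly + 1
  | .ifLt _ _ P Q => P.costPoly + Q.costPoly + 1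
  | .ifBelow _ _ P Q => P.costPoly + Q.costPoly + 1
  | .loop _ _ P => 1 + Polynomial.X * (P.costPoly + 1)
  | _ => 1

/-- The final state. -/
noncomputable def exec (below : ℕ → ℕ → Bool) (P : RamProg) (s : RamState) : RamState :=
  (P.run below s).1

variable (below : ℕ → ℕ → Bool)

theorem exec_seq (P Q : RamProg) (s : RamState) :
    (seq P Q).exec below s = Q.exec below (P.exec below s) := rfl

theorem exec_skip (s : RamState) : skip.exec below s = s := rfl

theorem exec_const (x c : ℕ) (s : RamState) : (const x c).exec below s = s.setReg x c := rfl

theorem exec_add (x y z : ℕ) (s : RamState) :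
    (add x y z).exec below s = s.setReg x (s.reg y + s.reg z) := rfl

theorem exec_load (x a y z : ℕ) (s : RamState) :
    (load x a y z).exec below s = s.setReg x (s.arr a (s.reg y) (s.reg z)) := rfl

theorem exec_store (a y z x : ℕ) (s : RamState) :
    (store a y z x).exec below s = s.setArr a (s.reg y) (s.reg z) (s.reg x) := rfl

theorem exec_ifEq (x y : ℕ) (P Q : RamProg) (s : RamState) :
    (ifEq x y P Q).exec below s =
      if s.reg x = s.reg y then P.exec below s else Q.exec below s := by
  unfold exec; rw [run]; split_ifs <;> rfl

theorem exec_ifLt (x y : ℕ) (P Q : RamProg) (s : RamState) :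
    (ifLt x y P Q).exec below s =
      if s.reg x < s.reg y then P.exec below s else Q.exec below s := by
  unfold exec; rw [run]; split_ifs <;> rfl

theorem exec_ifBelow (x y : ℕ) (P Q : RamProg) (s : RamState) :
    (ifBelow x y P Q).exec below s =
      if below (s.reg x) (s.reg y) then P.exec below s else Q.exec below s := by
  unfold exec; rw [run]; split_ifs <;> rfl

/-- A property that holds initially and is preserved by every round holds at the end of a loop. -/
theorem loop_induction (i x : ℕ) (P : RamProg) (s : RamState) (I : ℕ → RamState × ℕ → Prop)
    (h0 : I 0 (s, 1))
    (hs : ∀ j < s.reg x, ∀ a, I j a →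
      I (j + 1) (P.exec below (a.1.setReg i j), a.2 + (P.run below (a.1.setReg i j)).2 + 1)) :
    I (s.reg x) ((loop i x P).run below s) := by
  rw [run]
  have : ∀ n ≤ s.reg x, I n (Nat.rec (s, 1)
      (fun j acc =>
        ((P.run below (acc.1.setReg i j)).1, acc.2 + (P.run below (acc.1.setReg i j)).2 + 1))
      n) := by
    intro n
    induction n with
    | zero => intro _; exact h0
    | succ k ih => intro hk; exact hs k hk _ (ih (Nat.le_of_succ_le hk))
  exact this _ le_rfl

theorem exec_reg {P : RamProg} {y : ℕ} (h : y ∉ P.regs) (s : RamState) :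
    (P.exec below s).reg y = s.reg y := by
  induction P generalizing s with
  | skip => rfl
  | const | add | sub | load =>
    simp only [regs, List.mem_singleton] at h
    simp [exec, run, RamState.setReg, h]
  | store => rfl
  | seq P Q ihP ihQ =>
    simp only [regs, List.mem_append, not_or] at h
    rw [exec_seq, ihQ h.2, ihP h.1]
  | ifEq x z P Q ihP ihQ =>
    simp only [regs, List.mem_append, not_or] at h
    rw [exec_ifEq]; split_ifs
    exacts [ihP h.1 s, ihQ h.2 s]
  | ifLt x z P Q ihP ihQ =>
    simp only [regs, List.mem_append, not_or] at h
    rw [exec_ifLt]; split_ifs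
    exacts [ihP h.1 s, ihQ h.2 s]
  | ifBelow x z P Q ihP ihQ =>
    simp only [regs, List.mem_append, not_or] at h
    rw [exec_ifBelow]; split_ifs
    exacts [ihP h.1 s, ihQ h.2 s]
  | loop i x P ih =>
    simp only [regs, List.mem_cons, not_or] at h
    refine loop_induction below i x P s (fun _ a => a.1.reg y = s.reg y) rfl ?_
    intro j _ a ha
    rw [ih h.2, ← ha]
    simp [RamState.setReg, h.1]

theorem exec_arr {P : RamProg} {y : ℕ} (h : y ∉ P.arrs) (s : RamState) :
    (P.exec below s).arr y = s.arr y := by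
  induction P generalizing s with
  | skip | const | add | sub | load => rfl
  | store =>
    simp only [arrs, List.mem_singleton] at h
    simp [exec, run, RamState.setArr, h]
  | seq P Q ihP ihQ =>
    simp only [arrs, List.mem_append, not_or] at h
    rw [exec_seq, ihQ h.2, ihP h.1]
  | ifEq x z P Q ihP ihQ =>
    simp only [arrs, List.mem_append, not_or] at h
    rw [exec_ifEq]; split_ifs
    exacts [ihP h.1 s, ihQ h.2 s]
  | ifLt x z P Q ihP ihQ =>
    simp only [arrs, List.mem_append, not_or] at h
    rw [exec_ifLt]; split_ifs
    exacts [ihP h.1 s, ihQ h.2 s]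
  | ifBelow x z P Q ihP ihQ =>
    simp only [arrs, List.mem_append, not_or] at h
    rw [exec_ifBelow]; split_ifs
    exacts [ihP h.1 s, ihQ h.2 s]
  | loop i x P ih =>
    refine loop_induction below i x P s (fun _ a => a.1.arr y = s.arr y) rfl ?_
    intro j _ a ha
    rw [ih h, ← ha]
    rfl

/-- The registers outside `R` and the arrays outside `A` agree. -/
def Agree (R A : List ℕ) (s s' : RamState) : Prop :=
  (∀ y, y ∉ R → s'.reg y = s.reg y) ∧ ∀ a, a ∉ A → s'.arr a = s.arr a

/-- The frame conditions are carried along inside the induction, so an invariant need only speak of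
the memory that the loop body changes. -/
theorem exec_loop_inv {i x : ℕ} {P : RamProg} {s : RamState} (I : ℕ → RamState → Prop)
    (h0 : I 0 s)
    (hs : ∀ j < s.reg x, ∀ s', Agree (i :: P.regs) P.arrs s s' → I j s' →
      I (j + 1) (P.exec below (s'.setReg i j))) :
    I (s.reg x) ((loop i x P).exec below s) := by
  refine (loop_induction below i x P s
    (fun j a => Agree (i :: P.regs) P.arrs s a.1 ∧ I j a.1)
    ⟨⟨fun _ _ => rfl, fun _ _ => rfl⟩, h0⟩ ?_).2
  rintro j hj a ⟨⟨hr, ha⟩, hI⟩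
  refine ⟨⟨fun y hy => ?_, fun b hb => ?_⟩, hs j hj _ ⟨hr, ha⟩ hI⟩
  · have hy' := hy
    simp only [List.mem_cons, not_or] at hy
    rw [exec_reg below hy.2, ← hr y hy']
    simp [RamState.setReg, hy.1]
  · rw [exec_arr below hb, ← ha b hb]
    rfl

/-- No loop bound is ever overwritten, so each keeps its initial value, at most N, whenever its loop
starts. The cost then follows by recursion on the syntax. -/
theorem run_cost_le {P : RamProg} {N : ℕ} {s : RamState}
    (hb : ∀ x ∈ P.bounds, s.reg x ≤ N) (hw : P.regs.Disjoint P.bounds) :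
    (P.run below s).2 ≤ P.costPoly.eval N := by
  -- The protected registers B stay fixed while the program shrinks: a subprogram must spare not
  -- only its own loop bounds but also those of the code that runs after it.
  have key : ∀ (B : List ℕ) (P : RamProg) (s : RamState), (∀ x ∈ B, s.reg x ≤ N) →
      P.regs.Disjoint B → P.bounds ⊆ B → (P.run below s).2 ≤ P.costPoly.eval N := by
    intro B P
    induction P with
    | skip | const | add | sub | load | store => intro s _ _ _; simp [run, costPoly]
    | seq P Q ihP ihQ =>
      intro s hs hd hB
      simp only [regs, bounds, List.disjoint_append_left, List.append_subset] at hd hB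
      simp only [run, costPoly, Polynomial.eval_add]
      refine add_le_add (ihP s hs hd.1 hB.1) (ihQ _ ?_ hd.2 hB.2)
      intro x hx
      have := exec_reg below (fun h => hd.1 h hx) s
      unfold exec at this
      rw [this]
      exact hs x hx
    | ifEq x y P Q ihP ihQ | ifLt x y P Q ihP ihQ | ifBelow x y P Q ihP ihQ =>
      intro s hs hd hB
      simp only [regs, bounds, List.disjoint_append_left, List.append_subset] at hd hB
      have h1 := ihP s hs hd.1 hB.1
      have h2 := ihQ s hs hd.2 hB.2
      simp only [run, costPoly, Polynomial.eval_add, Polynomial.eval_one]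
      split_ifs <;> simp only <;> omega
    | loop i x P ih =>
      intro s hs hd hB
      simp only [regs, bounds, List.disjoint_cons_left, List.cons_subset] at hd hB
      have := loop_induction below i x P s
        (fun j a => (∀ x ∈ B, a.1.reg x ≤ N) ∧ a.2 ≤ 1 + j * (P.costPoly.eval N + 1))
        ⟨hs, by simp⟩ ?_
      · refine this.2.trans ?_
        simp only [costPoly, Polynomial.eval_add, Polynomial.eval_one, Polynomial.eval_mul,
          Polynomial.eval_X]
        gcongr
        exact hs x hB.1
      · rintro j _ a ⟨h1, h2⟩
        have h3 : ∀ x ∈ B, (a.1.setReg i j).reg x ≤ N := by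
          intro x hx
          have : x ≠ i := fun h => hd.1 (h ▸ hx)
          simpa [RamState.setReg, this] using h1 x hx
        refine ⟨fun x hx => ?_, ?_⟩
        · rw [exec_reg below (fun h => hd.2 h hx)]
          exact h3 x hx
        · have := ih _ h3 hd.2 hB.2
          simp only
          linarith
  exact key P.bounds P s hb hw (List.Subset.refl _)

end RamProg
/-! ### A program for clustering and majority decoding -/

namespace RamProg

variable (below : ℕ → ℕ → Bool)

/-- Copies the transpose of array `0` to array `3`. -/
def transposeProg : RamProg :=
  loop 2 0 (loop 3 1 (seq (load 8 0 2 3) (store 3 3 2 8)))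

/-- Puts the numbers of common and of differing positions of the rows `reg 2` and `reg 3` of array
`A` into the registers `6` and `7`. The rows have `reg N` entries. -/
def distProg (A N : ℕ) : RamProg :=
  seq (const 6 0) (seq (const 7 0) (loop 4 N (seq (load 8 A 2 4) (seq (load 9 A 3 4)
    (ifEq 8 5 skip (ifEq 9 5 skip (seq (add 6 6 10) (ifEq 8 9 skip (add 7 7 10)))))))))

/-- For the rows of array `A`, puts the indicators of the estimated clusters into array `B` and
their first elements into array `B + 1`. -/
def clusterProg (A B M N : ℕ) : RamProg :=
  loop 2 M (seq (add 12 2 13) (seq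
    (loop 3 M (seq (distProg A N) (ifBelow 7 6
      (seq (store B 2 3 10) (ifLt 3 12 (add 12 3 13) skip)) (store B 2 3 13))))
    (store (B + 1) 2 13 12)))

/-- Puts the numbers of zeros and ones in the product of the clusters `reg 2` and `reg 3` into the
registers `6` and `7`. -/
def voteProg : RamProg :=
  seq (const 6 0) (seq (const 7 0) (loop 4 0 (loop 11 1 (seq (load 8 4 2 4) (seq (load 9 6 3 11)
    (seq (load 14 0 4 11) (ifEq 8 10 (ifEq 9 10 (ifEq 14 13 (add 6 6 10)
      (ifEq 14 10 (add 7 7 10) skip)) skip) skip)))))))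

/-- Stores the majority value, or else the tie-breaking bit. -/
def decideProg : RamProg :=
  ifLt 7 6 (store 2 2 3 13) (ifLt 6 7 (store 2 2 3 10)
    (seq (load 8 5 2 13) (seq (load 9 7 3 13) (seq (load 8 1 8 9) (store 2 2 3 8)))))

/-- The program that computes `clusterMajority`. -/
def clusterMajorityProg : RamProg :=
  seq (const 5 2) (seq (const 10 1) (seq transposeProg (seq (clusterProg 0 4 0 1)
    (seq (clusterProg 3 6 1 0) (loop 2 0 (loop 3 1 (seq voteProg decideProg)))))))

theorem exec_transposeProg (s : RamState) (i k : ℕ) (hi : i < s.reg 0) (hk : k < s.reg 1) :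
    (transposeProg.exec below s).arr 3 k i = s.arr 0 i k := by
  refine exec_loop_inv below (fun i' s' => ∀ i < i', ∀ k < s.reg 1, s'.arr 3 k i = s.arr 0 i k)
    (by simp) ?_ i hi k hk
  intro i' hi' s₁ h₁ hI
  have e0 : s₁.arr 0 = s.arr 0 := h₁.2 0 (by decide)
  have e1 : s₁.reg 1 = s.reg 1 := h₁.1 1 (by decide)
  -- The inner invariant covers all entries that precede (i', k') in lexicographic order, so the
  -- rows already copied are not lost.
  have := exec_loop_inv below (i := 3) (x := 1) (P := seq (load 8 0 2 3) (store 3 3 2 8))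
    (s := s₁.setReg 2 i')
    (fun k' s' => ∀ i k, (i < i' ∨ i = i' ∧ k < k') → k < s.reg 1 → s'.arr 3 k i = s.arr 0 i k)
    ?_ ?_
  · intro i hi k hk
    refine this i k ?_ hk
    have : (s₁.setReg 2 i').reg 1 = s.reg 1 := e1
    rw [this]
    omega
  · intro i k hik hk
    exact hI i (by omega) k hk
  · intro k' hk' s₂ h₂ hJ i k hik hk
    have e2 : s₂.reg 2 = i' := h₂.1 2 (by decide)
    have e3 : s₂.arr 0 = s.arr 0 := (h₂.2 0 (by decide)).trans e0
    simp only [exec_seq, exec_load, exec_store, RamState.setReg, RamState.setArr]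
    simp only [Function.update, e2, e3]
    simp
    split_ifs with hc
    · rw [hc.1, hc.2]
    · exact hJ i k (by omega) hk

/-- Register 5 holds the code of an erasure and register 10 the increment one. The condition N ≤ 1
separates the loop bound from the scratch registers. -/
theorem exec_distProg (A N : ℕ) (hN : N ≤ 1) (s : RamState) (h5 : s.reg 5 = 2)
    (h10 : s.reg 10 = 1) :
    ((distProg A N).exec below s).reg 6 = ∑ k ∈ Finset.range (s.reg N),
      (if s.arr A (s.reg 2) k ≠ 2 ∧ s.arr A (s.reg 3) k ≠ 2 then 1 else 0) ∧
    ((distProg A N).exec below s).reg 7 = ∑ k ∈ Finset.range (s.reg N),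
      (if s.arr A (s.reg 2) k ≠ 2 ∧ s.arr A (s.reg 3) k ≠ 2 ∧
        s.arr A (s.reg 2) k ≠ s.arr A (s.reg 3) k then 1 else 0) := by
  have hN' : ((s.setReg 6 0).setReg 7 0).reg N = s.reg N := by
    simp [RamState.setReg, Function.update, show N ≠ 6 by omega, show N ≠ 7 by omega]
  rw [distProg, exec_seq, exec_seq, exec_const, exec_const, ← hN']
  refine exec_loop_inv below (fun k' s' =>
    s'.reg 6 = ∑ k ∈ Finset.range k', (if s.arr A (s.reg 2) k ≠ 2 ∧ s.arr A (s.reg 3) k ≠ 2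
      then 1 else 0) ∧
    s'.reg 7 = ∑ k ∈ Finset.range k', (if s.arr A (s.reg 2) k ≠ 2 ∧ s.arr A (s.reg 3) k ≠ 2 ∧
        s.arr A (s.reg 2) k ≠ s.arr A (s.reg 3) k then 1 else 0)) ?_ ?_
  · simp [RamState.setReg, Function.update]
  · rintro k hk s₁ h₁ ⟨h6, h7⟩
    have e2 : s₁.reg 2 = s.reg 2 := h₁.1 2 (by simp [regs])
    have e3 : s₁.reg 3 = s.reg 3 := h₁.1 3 (by simp [regs])
    have e5 : s₁.reg 5 = 2 := (h₁.1 5 (by simp [regs])).trans h5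
    have e10 : s₁.reg 10 = 1 := (h₁.1 10 (by simp [regs])).trans h10
    have eA : s₁.arr A = s.arr A := h₁.2 A (by simp [arrs])
    rw [Finset.sum_range_succ, Finset.sum_range_succ, ← h6, ← h7]
    by_cases hc1 : s.arr A (s.reg 2) k = 2
    · simp [exec_seq, exec_load, exec_ifEq, exec_skip, RamState.setReg,
        Function.update, e2, e3, e5, eA, hc1]
    by_cases hc2 : s.arr A (s.reg 3) k = 2
    · simp [exec_seq, exec_load, exec_ifEq, exec_skip, RamState.setReg,
        Function.update, e2, e3, e5, eA, hc1, hc2]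
    by_cases hc3 : s.arr A (s.reg 2) k = s.arr A (s.reg 3) k
    · simp [exec_seq, exec_load, exec_ifEq, exec_skip, exec_add, RamState.setReg,
        Function.update, e2, e3, e5, e10, eA, hc2, hc3]
    · simp [exec_seq, exec_load, exec_ifEq, exec_add, RamState.setReg,
        Function.update, e2, e3, e5, e10, eA, hc1, hc2, hc3]

/-- `v` is the least among `i` and the elements below `J` with property `p`. -/
def IsFirst (p : ℕ → Prop) (i J v : ℕ) : Prop :=
  v ≤ i ∧ (v = i ∨ p v) ∧ ∀ j < J, p j → v ≤ j

/-- Whether the rows `i` and `j` of an array with `c` columns are estimated to be in the same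
cluster. -/
def Near (a : ℕ → ℕ → ℕ) (c i j : ℕ) : Prop :=
  below (∑ k ∈ Finset.range c, (if a i k ≠ 2 ∧ a j k ≠ 2 ∧ a i k ≠ a j k then 1 else 0))
    (∑ k ∈ Finset.range c, (if a i k ≠ 2 ∧ a j k ≠ 2 then 1 else 0)) = true

instance (a : ℕ → ℕ → ℕ) (c i j : ℕ) : Decidable (Near below a c i j) :=
  inferInstanceAs (Decidable (_ = true))

/-- Register 12 is a running minimum that starts at i. The conditions on A and B keep the input
array from being overwritten; A, M and N are parameters so that the same code serves the rows and,
on the transposed array, the columns. -/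
theorem exec_clusterProg (A B M N : ℕ) (hM : M ≤ 1) (hN : N ≤ 1) (hAB : A ≠ B) (hAB' : A ≠ B + 1)
    (s : RamState) (h5 : s.reg 5 = 2) (h10 : s.reg 10 = 1) (h13 : s.reg 13 = 0) (i : ℕ)
    (hi : i < s.reg M) :
    (∀ j < s.reg M, ((clusterProg A B M N).exec below s).arr B i j =
      if Near below (s.arr A) (s.reg N) i j then 1 else 0) ∧
    IsFirst (fun j => j < s.reg M ∧ Near below (s.arr A) (s.reg N) i j) i (s.reg M)
      (((clusterProg A B M N).exec below s).arr (B + 1) i 0) := by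
  refine exec_loop_inv below (fun i' s' => ∀ i < i',
    (∀ j < s.reg M, s'.arr B i j = if Near below (s.arr A) (s.reg N) i j then 1 else 0) ∧
    IsFirst (fun j => j < s.reg M ∧ Near below (s.arr A) (s.reg N) i j) i (s.reg M)
      (s'.arr (B + 1) i 0)) (by simp) ?_ i hi
  clear hi i
  intro i' hi' s₁ h₁ hI
  have hM0 : ∀ x, 2 ≤ x → M ≠ x := fun x hx => by omega
  have hN0 : ∀ x, 2 ≤ x → N ≠ x := fun x hx => by omega
  have e5 : s₁.reg 5 = 2 := (h₁.1 5 (by simp [regs, distProg])).trans h5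
  have e10 : s₁.reg 10 = 1 := (h₁.1 10 (by simp [regs, distProg])).trans h10
  have e13 : s₁.reg 13 = 0 := (h₁.1 13 (by simp [regs, distProg])).trans h13
  have eA : s₁.arr A = s.arr A := h₁.2 A (by simp [arrs, distProg, hAB, hAB'])
  have eM : s₁.reg M = s.reg M := h₁.1 M (by simp [regs, distProg, hM0])
  have eN : s₁.reg N = s.reg N := h₁.1 N (by simp [regs, distProg, hN0])
  rw [exec_seq, exec_seq, exec_store]
  set P := seq (distProg A N) (ifBelow 7 6
      (seq (store B 2 3 10) (ifLt 3 12 (add 12 3 13) skip)) (store B 2 3 13)) with hP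
  set s₂ := (add 12 2 13).exec below (s₁.setReg 2 i') with hs₂
  have f2 : s₂.reg 2 = i' := by simp [hs₂, exec_add, RamState.setReg, Function.update]
  have f12 : s₂.reg 12 = i' := by simp [hs₂, exec_add, RamState.setReg, Function.update, e13]
  have f5 : s₂.reg 5 = 2 := by simp [hs₂, exec_add, RamState.setReg, Function.update, e5]
  have f10 : s₂.reg 10 = 1 := by simp [hs₂, exec_add, RamState.setReg, Function.update, e10]
  have f13 : s₂.reg 13 = 0 := by simp [hs₂, exec_add, RamState.setReg, Function.update, e13]
  have fM : s₂.reg M = s.reg M := by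
    simp [hs₂, exec_add, RamState.setReg, Function.update, hM0, eM]
  have fN : s₂.reg N = s.reg N := by
    simp [hs₂, exec_add, RamState.setReg, Function.update, hN0, eN]
  have fa : s₂.arr = s₁.arr := rfl
  -- The first clause protects the finished rows of array B, the second describes the current row so
  -- far, and the third is the running minimum.
  have main := exec_loop_inv below (i := 3) (x := M) (P := P) (s := s₂)
    (fun j' s' =>
      (∀ i j, i ≠ i' → s'.arr B i j = s₁.arr B i j) ∧
      (∀ j < j', s'.arr B i' j = if Near below (s.arr A) (s.reg N) i' j then 1 else 0) ∧
      IsFirst (fun j => j < s.reg M ∧ Near below (s.arr A) (s.reg N) i' j) i' j' (s'.reg 12))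
    ⟨fun _ _ _ => rfl, by simp, by simp [IsFirst, f12]⟩ ?_
  · rw [fM] at main
    set s₃ := (loop 3 M P).exec below s₂ with hs₃
    have g2 : s₃.reg 2 = i' := (exec_reg below (by simp [P, regs, distProg]) _).trans f2
    have g13 : s₃.reg 13 = 0 := (exec_reg below (by simp [P, regs, distProg]) _).trans f13
    have gB : s₃.arr (B + 1) = s₁.arr (B + 1) := by
      rw [hs₃, exec_arr below (by simp [P, distProg, arrs]), fa]
    intro i hi
    have k1 : ∀ j, (s₃.setArr (B + 1) (s₃.reg 2) (s₃.reg 13) (s₃.reg 12)).arr B i j =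
        s₃.arr B i j := by
      intro j; simp [RamState.setArr]
    simp only [k1]
    have k2 : (s₃.setArr (B + 1) (s₃.reg 2) (s₃.reg 13) (s₃.reg 12)).arr (B + 1) i 0 =
        if i = i' then s₃.reg 12 else s₁.arr (B + 1) i 0 := by
      simp [RamState.setArr, g2, g13, gB]
    rw [k2]
    by_cases hii : i = i'
    · subst hii
      rw [if_pos rfl]
      exact ⟨main.2.1, main.2.2⟩
    · rw [if_neg hii]
      simp only [main.1 i _ hii]
      exact hI i (by omega)
  · rintro j' hj' s₃ h₃ ⟨hJ1, hJ2, hJ3⟩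
    set s₄ := s₃.setReg 3 j' with hs₄
    have g2 : s₄.reg 2 = i' := (h₃.1 2 (by simp [P, regs, distProg])).trans f2
    have g3 : s₄.reg 3 = j' := rfl
    have g5 : s₄.reg 5 = 2 := (h₃.1 5 (by simp [P, regs, distProg])).trans f5
    have g10 : s₄.reg 10 = 1 := (h₃.1 10 (by simp [P, regs, distProg])).trans f10
    have g13 : s₄.reg 13 = 0 := (h₃.1 13 (by simp [P, regs, distProg])).trans f13
    have gA : s₄.arr A = s.arr A := by
      have : s₃.arr A = s₂.arr A := h₃.2 A (by simp [P, arrs, distProg, hAB])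
      rw [fa, eA] at this
      exact this
    have gN : s₄.reg N = s.reg N := by
      have : s₃.reg N = s₂.reg N := h₃.1 N (by simp [P, regs, distProg, hN0])
      rw [fN] at this
      rw [← this, hs₄]
      simp [RamState.setReg, Function.update, hN0]
    have g12 : s₄.reg 12 = s₃.reg 12 := rfl
    have gB : s₄.arr B = s₃.arr B := rfl
    obtain ⟨d6, d7⟩ := exec_distProg below A N hN s₄ g5 g10
    rw [hP, exec_seq, exec_ifBelow, d6, d7, g2, g3, gA, gN]
    set s₅ := (distProg A N).exec below s₄ with hs₅
    have k2 : s₅.reg 2 = i' := (exec_reg below (by simp [regs, distProg]) _).trans g2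
    have k3 : s₅.reg 3 = j' := (exec_reg below (by simp [regs, distProg]) _).trans g3
    have k10 : s₅.reg 10 = 1 := (exec_reg below (by simp [regs, distProg]) _).trans g10
    have k13 : s₅.reg 13 = 0 := (exec_reg below (by simp [regs, distProg]) _).trans g13
    have k12 : s₅.reg 12 = s₃.reg 12 := (exec_reg below (by simp [regs, distProg]) _).trans g12
    have kB : s₅.arr B = s₃.arr B := (exec_arr below (by simp [arrs, distProg]) _).trans gB
    have hjM : j' < s.reg M := by rw [← fM]; exact hj'
    change _ ∧ _ ∧ _
    by_cases hnear : Near below (s.arr A) (s.reg N) i' j'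
    · rw [if_pos (show below _ _ = true from hnear)]
      have arrE : ∀ i j, ((seq (store B 2 3 10) (ifLt 3 12 (add 12 3 13) skip)).exec below s₅).arr
          B i j = if i = i' ∧ j = j' then 1 else s₃.arr B i j := by
        intro i j
        rw [exec_seq, exec_arr below (by simp [arrs]), exec_store]
        simp [RamState.setArr, k2, k3, k10, kB]
      have regE : ((seq (store B 2 3 10) (ifLt 3 12 (add 12 3 13) skip)).exec below s₅).reg 12
          = min j' (s₃.reg 12) := by
        rw [exec_seq, exec_store, exec_ifLt]
        simp only [RamState.setArr, k3, k12]
        split_ifs with hlt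
        · simp [exec_add, RamState.setReg, k3, k13, hlt.le]
        · simp [exec_skip, k12]; omega
      simp only [arrE, regE]
      refine ⟨fun i j hi => by simp [hi, hJ1 i j hi], fun j hj => ?_, ?_⟩
      · by_cases hjj : j = j'
        · subst hjj; simp [hnear]
        · simp only [hjj, and_false, if_false]; exact hJ2 j (by omega)
      · obtain ⟨q1, q2, q3⟩ := hJ3
        refine ⟨by omega, ?_, ?_⟩
        · rcases le_total j' (s₃.reg 12) with h | h
          · rw [min_eq_left h]; exact Or.inr ⟨hjM, hnear⟩
          · rw [min_eq_right h]; exact q2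
        · intro j hj hp
          by_cases hjj : j = j'
          · omega
          · have := q3 j (by omega) hp
            omega
    · rw [if_neg (show ¬ below _ _ = true from hnear)]
      simp only [exec_store, RamState.setArr, k2, k3, k13, kB, k12]
      refine ⟨fun i j hi => by simp [hi, hJ1 i j hi], fun j hj => ?_, ?_⟩
      · by_cases hjj : j = j'
        · subst hjj; simp [hnear]
        · simp only [hjj, and_false, if_false]; exact hJ2 j (by omega)
      · obtain ⟨q1, q2, q3⟩ := hJ3
        refine ⟨q1, q2, ?_⟩
        intro j hj hp
        by_cases hjj : j = j'
        · exact absurd (hjj ▸ hp.2) hnear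
        · exact q3 j (by omega) hp

end RamProg
-- Correctness of the program
theorem mem_estCluster {m n : ℕ} {d₀ : ℝ} {y : Observations m n} {i j : Fin m} :
    j ∈ estCluster d₀ y i ↔ hammingRatio (y i) (y j) < d₀ := by
  unfold estCluster
  exact Finset.mem_filter_univ _

namespace RamProg

variable (below : ℕ → ℕ → Bool)

/-- The number of entries with value `v` in the product of two clusters. -/
def tally (s : RamState) (i k v : ℕ) : ℕ :=
  ∑ j ∈ Finset.range (s.reg 0), ∑ l ∈ Finset.range (s.reg 1),
    if s.arr 4 i j = 1 ∧ s.arr 6 k l = 1 ∧ s.arr 0 j l = v then 1 else 0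

theorem exec_voteProg (s : RamState) (h10 : s.reg 10 = 1) (h13 : s.reg 13 = 0) :
    (voteProg.exec below s).reg 6 = tally s (s.reg 2) (s.reg 3) 0 ∧
    (voteProg.exec below s).reg 7 = tally s (s.reg 2) (s.reg 3) 1 := by
  rw [voteProg, exec_seq, exec_seq, exec_const, exec_const]
  set s₀ := (s.setReg 6 0).setReg 7 0 with hs₀
  set body := seq (load 8 4 2 4) (seq (load 9 6 3 11)
    (seq (load 14 0 4 11) (ifEq 8 10 (ifEq 9 10 (ifEq 14 13 (add 6 6 10)
      (ifEq 14 10 (add 7 7 10) skip)) skip) skip))) with hbody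
  let f (v j l : ℕ) : ℕ :=
    if s.arr 4 (s.reg 2) j = 1 ∧ s.arr 6 (s.reg 3) l = 1 ∧ s.arr 0 j l = v then 1 else 0
  refine exec_loop_inv below (i := 4) (x := 0) (s := s₀) (fun j' s' =>
    s'.reg 6 = ∑ j ∈ Finset.range j', ∑ l ∈ Finset.range (s.reg 1), f 0 j l ∧
    s'.reg 7 = ∑ j ∈ Finset.range j', ∑ l ∈ Finset.range (s.reg 1), f 1 j l) ?_ ?_
  · simp [hs₀, RamState.setReg, Function.update]
  rintro j _ s₁ h₁ ⟨h6, h7⟩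
  have e1 : s₁.reg 1 = s.reg 1 := h₁.1 1 (by decide)
  have e2 : s₁.reg 2 = s.reg 2 := h₁.1 2 (by decide)
  have e3 : s₁.reg 3 = s.reg 3 := h₁.1 3 (by decide)
  have e10 : s₁.reg 10 = 1 := (h₁.1 10 (by decide)).trans h10
  have e13 : s₁.reg 13 = 0 := (h₁.1 13 (by decide)).trans h13
  have ea : s₁.arr = s.arr := funext fun a => h₁.2 a (by simp [arrs, body])
  have hn : (s₁.setReg 4 j).reg 1 = s.reg 1 := e1
  rw [Finset.sum_range_succ, Finset.sum_range_succ, ← h6, ← h7, ← hn]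
  refine exec_loop_inv below (i := 11) (x := 1) (s := s₁.setReg 4 j) (fun l' s' =>
    s'.reg 6 = s₁.reg 6 + ∑ l ∈ Finset.range l', f 0 j l ∧
    s'.reg 7 = s₁.reg 7 + ∑ l ∈ Finset.range l', f 1 j l) ?_ ?_
  · simp [RamState.setReg, Function.update]
  rintro l _ s₂ h₂ ⟨k6, k7⟩
  have f2 : s₂.reg 2 = s.reg 2 := (h₂.1 2 (by decide)).trans e2
  have f3 : s₂.reg 3 = s.reg 3 := (h₂.1 3 (by decide)).trans e3
  have f4 : s₂.reg 4 = j := h₂.1 4 (by decide)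
  have f10 : s₂.reg 10 = 1 := (h₂.1 10 (by decide)).trans e10
  have f13 : s₂.reg 13 = 0 := (h₂.1 13 (by decide)).trans e13
  have fa : s₂.arr = s.arr := by
    rw [← ea]; exact funext fun a => h₂.2 a (by simp [arrs, body])
  rw [Finset.sum_range_succ, Finset.sum_range_succ, ← add_assoc, ← add_assoc, ← k6, ← k7]
  by_cases c1 : s.arr 4 (s.reg 2) j = 1
  · by_cases c2 : s.arr 6 (s.reg 3) l = 1
    · by_cases c3 : s.arr 0 j l = 0
      · simp [hbody, exec_seq, exec_load, exec_ifEq, exec_add, RamState.setReg,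
          Function.update, f2, f3, f4, f10, f13, fa, f, c1, c2, c3]
      · by_cases c4 : s.arr 0 j l = 1
        · simp [hbody, exec_seq, exec_load, exec_ifEq, exec_add, RamState.setReg,
            Function.update, f2, f3, f4, f10, f13, fa, f, c1, c2, c4]
        · simp [hbody, exec_seq, exec_load, exec_ifEq, exec_skip, RamState.setReg,
            Function.update, f2, f3, f4, f10, f13, fa, f, c1, c2, c3, c4]
    · simp [hbody, exec_seq, exec_load, exec_ifEq, exec_skip, RamState.setReg,
        Function.update, f2, f3, f4, f10, fa, f, c1, c2]
  · simp [hbody, exec_seq, exec_load, exec_ifEq, exec_skip, RamState.setReg,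
      Function.update, f2, f3, f4, f10, fa, f, c1]

theorem exec_decideProg (s : RamState) (h10 : s.reg 10 = 1) (h13 : s.reg 13 = 0) (i k : ℕ) :
    (decideProg.exec below s).arr 2 i k =
      if i = s.reg 2 ∧ k = s.reg 3 then
        if s.reg 7 < s.reg 6 then 0 else if s.reg 6 < s.reg 7 then 1
        else s.arr 1 (s.arr 5 (s.reg 2) 0) (s.arr 7 (s.reg 3) 0)
      else s.arr 2 i k := by
  rw [decideProg, exec_ifLt, exec_ifLt]
  split_ifs <;> simp_all [exec_seq, exec_load, exec_store, RamState.setReg, RamState.setArr,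
    Function.update]

/-- The decision for the entry `(i, k)`. -/
def decision (s : RamState) (i k : ℕ) : ℕ :=
  if tally s i k 1 < tally s i k 0 then 0 else if tally s i k 0 < tally s i k 1 then 1
  else s.arr 1 (s.arr 5 i 0) (s.arr 7 k 0)

theorem exec_decision (s : RamState) (h10 : s.reg 10 = 1) (h13 : s.reg 13 = 0) (i k : ℕ)
    (hi : i < s.reg 0) (hk : k < s.reg 1) :
    ((loop 2 0 (loop 3 1 (seq voteProg decideProg))).exec below s).arr 2 i k
      = decision s i k := by
  refine exec_loop_inv below (fun i' s' => ∀ i < i', ∀ k < s.reg 1, s'.arr 2 i k = decision s i k)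
    (by simp) ?_ i hi k hk
  clear hi i hk k
  intro i' _ s₁ h₁ hI
  have e0 : s₁.reg 0 = s.reg 0 := h₁.1 0 (by decide)
  have e1 : s₁.reg 1 = s.reg 1 := h₁.1 1 (by decide)
  have e10 : s₁.reg 10 = 1 := (h₁.1 10 (by decide)).trans h10
  have e13 : s₁.reg 13 = 0 := (h₁.1 13 (by decide)).trans h13
  have := exec_loop_inv below (i := 3) (x := 1) (P := seq voteProg decideProg)
    (s := s₁.setReg 2 i')
    (fun k' s' => ∀ i k, (i < i' ∨ i = i' ∧ k < k') → k < s.reg 1 →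
      s'.arr 2 i k = decision s i k) ?_ ?_
  · intro i hi k hk
    refine this i k ?_ hk
    have : (s₁.setReg 2 i').reg 1 = s.reg 1 := e1
    rw [this]
    omega
  · intro i k hik hk
    exact hI i (by omega) k hk
  · intro k' _ s₂ h₂ hJ i k hik hk
    set s₃ := s₂.setReg 3 k' with hs₃
    have f0 : s₃.reg 0 = s.reg 0 := (h₂.1 0 (by decide)).trans e0
    have f1 : s₃.reg 1 = s.reg 1 := (h₂.1 1 (by decide)).trans e1
    have f2 : s₃.reg 2 = i' := h₂.1 2 (by decide)
    have f3 : s₃.reg 3 = k' := rfl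
    have f10 : s₃.reg 10 = 1 := (h₂.1 10 (by decide)).trans e10
    have f13 : s₃.reg 13 = 0 := (h₂.1 13 (by decide)).trans e13
    have fa : ∀ a, a ≠ 2 → s₃.arr a = s.arr a := fun a ha =>
      (h₂.2 a (by simp [arrs, voteProg, decideProg, ha])).trans
        (h₁.2 a (by simp [arrs, voteProg, decideProg, ha]))
    have ft : ∀ i k v, tally s₃ i k v = tally s i k v := by
      intro i k v
      simp only [tally, f0, f1, fa 4 (by decide), fa 6 (by decide), fa 0 (by decide)]
    obtain ⟨v6, v7⟩ := exec_voteProg below s₃ f10 f13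
    have g : ∀ a, (voteProg.exec below s₃).arr a = s₃.arr a := fun a =>
      exec_arr below (by simp [arrs, voteProg]) _
    rw [exec_seq, exec_decideProg below _ ((exec_reg below (by decide) _).trans f10)
      ((exec_reg below (by decide) _).trans f13), v6, v7,
      exec_reg below (by decide) s₃, exec_reg below (by decide) s₃, f2, f3, ft, ft, g, g, g, g,
      fa 1 (by decide), fa 5 (by decide), fa 7 (by decide)]
    by_cases hc : i = i' ∧ k = k'
    · rw [if_pos hc, decision, hc.1, hc.2]
    · rw [if_neg hc]
      exact hJ i k (by omega) hk

theorem symbolCode_eq_two {o : Option Bool} : symbolCode o = 2 ↔ o = none := by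
  rcases o with _ | _ | _ <;> simp [symbolCode]

theorem symbolCode_injective : Function.Injective symbolCode := by
  intro a b
  rcases a with _ | _ | _ <;> rcases b with _ | _ | _ <;> simp [symbolCode]

theorem near_iff {m n : ℕ} (d₀ : ℝ) (y : Observations m n) (a : ℕ → ℕ → ℕ)
    (ha : ∀ (i : Fin m) (k : Fin n), a i k = symbolCode (y i k)) (i j : Fin m) :
    Near (belowThreshold d₀) a n i j ↔ j ∈ estCluster d₀ y i := by
  rw [mem_estCluster, Near, Finset.sum_range, Finset.sum_range, belowThreshold, hammingRatio,
    disagreeCount, commonCount, Finset.card_filter, Finset.card_filter]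
  simp only [ha, ne_eq, symbolCode_eq_two, symbolCode_injective.eq_iff, decide_eq_true_eq]

theorem IsFirst.eq_estRep {m n : ℕ} {d₀ : ℝ} (hd : 0 < d₀) {y : Observations m n}
    {a : ℕ → ℕ → ℕ} (ha : ∀ (i : Fin m) (k : Fin n), a i k = symbolCode (y i k)) {i : Fin m}
    {v : ℕ} (h : IsFirst (fun j => j < m ∧ Near (belowThreshold d₀) a n i j) i m v) :
    v = estRep d₀ y i := by
  -- A row has distance zero to itself and d₀ is positive. Hence the starting value i of the running
  -- minimum is itself a member, and the default in `estRep` is never used.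
  have hi : i ∈ estCluster d₀ y i := by
    have : disagreeCount (y i) (y i) = 0 := by simp [disagreeCount]
    simp [mem_estCluster, hammingRatio, this, hd]
  have hmem : ∃ hv : v < m, (⟨v, hv⟩ : Fin m) ∈ estCluster d₀ y i := by
    rcases h.2.1 with h | h
    · exact ⟨h ▸ i.2, by simpa [h] using hi⟩
    · exact ⟨h.1, (near_iff d₀ y a ha i ⟨v, h.1⟩).1 h.2⟩
  obtain ⟨hv, hmem⟩ := hmem
  have : (estCluster d₀ y i).min = ((⟨v, hv⟩ : Fin m) : WithTop (Fin m)) := by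
    refine le_antisymm (Finset.min_le hmem) (Finset.le_min ?_)
    intro b hb
    exact WithTop.coe_le_coe.2 (h.2.2 b b.2 ⟨b.2, (near_iff d₀ y a ha i b).2 hb⟩)
  simp [estRep, this]

theorem runsWithin_clusterMajorityProg {d₀ : ℝ} (hd : 0 < d₀) :
    RunsWithin d₀ clusterMajorityProg clusterMajorityProg.costPoly := by
  intro m n τ y
  constructor
  · refine run_cost_le (N := m + n) _ ?_ ?_
    · have : ∀ x ∈ clusterMajorityProg.bounds, x = 0 ∨ x = 1 := by decide
      intro x hx
      rcases this x hx with rfl | rfl <;> simp [ramInput]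
    · intro x hx hx'
      have : ∀ x ∈ clusterMajorityProg.bounds, x ∉ clusterMajorityProg.regs := by decide
      exact this x hx' hx
  intro i k
  set b := belowThreshold d₀
  set s₀ := ((ramInput τ y).setReg 5 2).setReg 10 1 with hs₀
  set s₁ := transposeProg.exec b s₀ with hs₁
  set s₂ := (clusterProg 0 4 0 1).exec b s₁ with hs₂
  set s₃ := (clusterProg 3 6 1 0).exec b s₂ with hs₃
  change ((loop 2 0 (loop 3 1 (seq voteProg decideProg))).exec b s₃).arr 2 i k = _
  have r0 : s₀.reg 0 = m := by simp [hs₀, RamState.setReg, ramInput]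
  have r1 : s₀.reg 1 = n := by simp [hs₀, RamState.setReg, ramInput]
  have r5 : s₀.reg 5 = 2 := by simp [hs₀, RamState.setReg]
  have r10 : s₀.reg 10 = 1 := by simp [hs₀, RamState.setReg]
  have r13 : s₀.reg 13 = 0 := by simp [hs₀, RamState.setReg, ramInput]
  have a0 : ∀ (i : Fin m) (k : Fin n), s₀.arr 0 i k = symbolCode (y i k) := by
    simp [hs₀, RamState.setReg, ramInput]
  have a1 : ∀ (i : Fin m) (k : Fin n), s₀.arr 1 i k = symbolCode (some (τ i k)) := by
    simp [hs₀, RamState.setReg, ramInput]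
  have t : ∀ x ∈ [0, 1, 5, 10, 13], s₁.reg x = s₀.reg x := fun x hx =>
    exec_reg b (by revert hx; revert x; decide) s₀
  have t' : ∀ x ∈ [0, 1, 5, 10, 13], s₂.reg x = s₀.reg x := fun x hx =>
    (exec_reg b (by revert hx; revert x; decide) s₁).trans (t x hx)
  have t'' : ∀ x ∈ [0, 1, 5, 10, 13], s₃.reg x = s₀.reg x := fun x hx =>
    (exec_reg b (by revert hx; revert x; decide) s₂).trans (t' x hx)
  have b1 : ∀ a ∈ [0, 1], s₁.arr a = s₀.arr a := fun x hx =>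
    exec_arr b (by revert hx; revert x; decide) s₀
  have b2 : ∀ a ∈ [0, 1, 3], s₂.arr a = s₁.arr a := fun x hx =>
    exec_arr b (by revert hx; revert x; decide) s₁
  have b3 : ∀ a ∈ [0, 1, 4, 5], s₃.arr a = s₂.arr a := fun x hx =>
    exec_arr b (by revert hx; revert x; decide) s₂
  have c0 : ∀ (i : Fin m) (k : Fin n), s₁.arr 0 i k = symbolCode (y i k) := by
    rw [b1 0 (by decide)]; exact a0
  have c3 : ∀ (k : Fin n) (i : Fin m), s₂.arr 3 k i = symbolCode (flipObs y k i) := by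
    intro k i
    rw [b2 3 (by decide), hs₁, exec_transposeProg b s₀ i k (by rw [r0]; exact i.2)
      (by rw [r1]; exact k.2)]
    exact a0 i k
  have T0 := t 0 (by decide); have T1 := t 1 (by decide)
  have T0' := t' 0 (by decide); have T1' := t' 1 (by decide)
  rw [r0] at T0 T0'; rw [r1] at T1 T1'
  obtain ⟨u1, u2⟩ := exec_clusterProg b 0 4 0 1 (by decide) (by decide) (by decide) (by decide) s₁
    ((t 5 (by decide)).trans r5) ((t 10 (by decide)).trans r10) ((t 13 (by decide)).trans r13)
    i (by rw [T0]; exact i.2)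
  obtain ⟨w1, w2⟩ := exec_clusterProg b 3 6 1 0 (by decide) (by decide) (by decide) (by decide) s₂
    ((t' 5 (by decide)).trans r5) ((t' 10 (by decide)).trans r10) ((t' 13 (by decide)).trans r13)
    k (by rw [T1']; exact k.2)
  rw [T0, T1] at u1 u2
  rw [T0', T1'] at w1 w2
  have v1 := u2.eq_estRep hd c0
  have v2 := w2.eq_estRep hd c3
  have x4 : ∀ j : Fin m, s₃.arr 4 i j = 1 ↔ j ∈ estCluster d₀ y i := by
    intro j
    rw [b3 4 (by decide), hs₂, u1 j j.2, ← near_iff d₀ y _ c0]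
    simp [b]
  have x6 : ∀ l : Fin n, s₃.arr 6 k l = 1 ↔ l ∈ estCluster d₀ (flipObs y) k := by
    intro l
    rw [hs₃, w1 l l.2, ← near_iff d₀ (flipObs y) _ c3]
    simp [b]
  have x0 : ∀ (i : Fin m) (k : Fin n), s₃.arr 0 i k = symbolCode (y i k) := by
    rw [b3 0 (by decide), b2 0 (by decide)]; exact c0
  have x1 : ∀ (i : Fin m) (k : Fin n), s₃.arr 1 i k = symbolCode (some (τ i k)) := by
    rw [b3 1 (by decide), b2 1 (by decide), b1 1 (by decide)]; exact a1
  have x5 : s₃.arr 5 i 0 = estRep d₀ y i := by rw [b3 5 (by decide)]; exact v1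
  have x7 : s₃.arr 7 k 0 = estRep d₀ (flipObs y) k := v2
  have S0 := (t'' 0 (by decide)).trans r0
  have S1 := (t'' 1 (by decide)).trans r1
  have tl : ∀ c : Bool, tally s₃ i k (symbolCode (some c)) = votes d₀ y i k c := by
    intro c
    simp only [tally, S0, S1, Finset.sum_range, x4, x6, x0, symbolCode_injective.eq_iff]
    rw [votes, Finset.card_filter, Finset.sum_product, ← Finset.sum_subset
      (Finset.subset_univ (estCluster d₀ y i)) (fun j _ hj => by simp [hj])]
    refine Finset.sum_congr rfl fun j hj => ?_
    rw [← Finset.sum_subset (Finset.subset_univ (estCluster d₀ (flipObs y) k))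
      (fun l _ hl => by simp [hl])]
    refine Finset.sum_congr rfl fun l hl => ?_
    simp [hj, hl]
  rw [exec_decision b s₃ ((t'' 10 (by decide)).trans r10) ((t'' 13 (by decide)).trans r13) i k
    (by rw [S0]; exact i.2) (by rw [S1]; exact k.2), decision, x5, x7, x1]
  have tl0 := tl false
  have tl1 := tl true
  simp only [symbolCode] at tl0 tl1
  rw [tl0, tl1, clusterMajority]
  split_ifs <;> rfl

end RamProg
/-! ### Finite weighted spaces -/

section Weights

variable {α β ι κ O : Type*} [Fintype α] [Fintype β] [Fintype ι] [Fintype κ] [Fintype O]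

open Classical in
/-- The total weight of an event. -/
noncomputable def massOf (P : α → ℝ) (E : α → Prop) : ℝ := ∑ a with E a, P a

theorem massOf_eq_sum_ite (P : α → ℝ) (E : α → Prop) [DecidablePred E] :
    massOf P E = ∑ a, if E a then P a else 0 := by
  rw [massOf, Finset.sum_filter]
  exact Finset.sum_congr rfl fun a _ => by congr

theorem massOf_mono {P : α → ℝ} (hP : ∀ a, 0 ≤ P a) {E F : α → Prop} (h : ∀ a, E a → F a) :
    massOf P E ≤ massOf P F := by
  classical
  exact Finset.sum_le_sum_of_subset_of_nonneg (Finset.monotone_filter_right _ fun a _ => h a)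
    fun a _ _ => hP a

theorem massOf_or_le {P : α → ℝ} (hP : ∀ a, 0 ≤ P a) (E F : α → Prop) :
    massOf P (fun a => E a ∨ F a) ≤ massOf P E + massOf P F := by
  classical
  simp only [massOf_eq_sum_ite]
  rw [← Finset.sum_add_distrib]
  refine Finset.sum_le_sum fun a _ => ?_
  have := hP a
  by_cases h1 : E a <;> by_cases h2 : F a <;> simp [h1, h2, this]

theorem massOf_exists_le {P : α → ℝ} (hP : ∀ a, 0 ≤ P a) (E : ι → α → Prop) :
    massOf P (fun a => ∃ i, E i a) ≤ ∑ i, massOf P (E i) := by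
  classical
  simp only [massOf_eq_sum_ite]
  rw [Finset.sum_comm]
  refine Finset.sum_le_sum fun a _ => ?_
  have hn : ∀ i ∈ Finset.univ, 0 ≤ if E i a then P a else 0 := fun i _ => by
    split_ifs
    exacts [hP a, le_rfl]
  split_ifs with h
  · obtain ⟨i, hi⟩ := h
    refine le_trans ?_ (Finset.single_le_sum hn (Finset.mem_univ i))
    simp [hi]
  · exact Finset.sum_nonneg hn

theorem massOf_equiv (e : α ≃ β) {P : α → ℝ} {Q : β → ℝ} (h : ∀ a, P a = Q (e a))
    (E : β → Prop) : massOf P (fun a => E (e a)) = massOf Q E := by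
  classical
  simp only [massOf_eq_sum_ite]
  exact Fintype.sum_equiv e _ _ fun a => by rw [h]

theorem massOf_prod (P : α → ℝ) (Q : α → β → ℝ) (E : α × β → Prop) :
    massOf (fun a : α × β => P a.1 * Q a.1 a.2) E =
      ∑ a, P a * massOf (Q a) (fun b => E (a, b)) := by
  classical
  simp only [massOf_eq_sum_ite]
  rw [Fintype.sum_prod_type]
  refine Finset.sum_congr rfl fun a _ => ?_
  rw [Finset.mul_sum]
  exact Finset.sum_congr rfl fun b _ => by split_ifs <;> simp

variable [DecidableEq ι] [DecidableEq κ]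

theorem sum_prod_prod (f : ι → κ → O → ℝ) :
    ∑ y : ι → κ → O, ∏ i, ∏ k, f i k (y i k) = ∏ i, ∏ k, ∑ o, f i k o := by
  rw [← Fintype.prod_sum (fun i (z : κ → O) => ∏ k, f i k (z k))]
  exact Finset.prod_congr rfl fun i _ => (Fintype.prod_sum fun k o => f i k o).symm

/-- Independence: the coordinates other than i and j sum to one and drop out. -/
theorem sum_prod_pair {i j : ι} (hij : i ≠ j) (w : ι → O → ℝ) (hw : ∀ i, ∑ o, w i o = 1)
    (G : O → O → ℝ) :
    ∑ z : ι → O, (∏ l, w l (z l)) * G (z i) (z j) = ∑ a, ∑ b, w i a * w j b * G a b := by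
  classical
  -- Fixing the two values by indicators that factor over the coordinates keeps the summand a
  -- product, so the sum of products is a product of sums.
  have h1 : ∀ a b, ∑ z : ι → O, ∏ l, (w l (z l) * (if l = i then if z l = a then 1 else 0 else 1)
      * (if l = j then if z l = b then 1 else 0 else 1)) = w i a * w j b := by
    intro a b
    rw [← Fintype.prod_sum (fun l o => w l o * (if l = i then if o = a then 1 else 0 else 1)
      * (if l = j then if o = b then 1 else 0 else 1))]
    have : ∀ l, ∑ o, w l o * (if l = i then if o = a then 1 else 0 else 1)
        * (if l = j then if o = b then 1 else 0 else 1) =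
        (if l = i then w i a else 1) * (if l = j then w j b else 1) := by
      intro l
      by_cases h : l = i
      · subst h
        simp [hij]
      · by_cases h' : l = j
        · subst h'
          simp [h]
        · simp [h, h', hw]
    simp only [this, Finset.prod_mul_distrib]
    simp
  simp only [← h1, Finset.sum_mul]
  rw [Finset.sum_congr rfl fun a _ => Finset.sum_comm, Finset.sum_comm]
  refine Finset.sum_congr rfl fun z _ => ?_
  simp only [Finset.prod_mul_distrib]
  simp

/-- Whole rows are taken as the independent coordinates, which removes all rows but two; the columns
then factorise. -/
theorem sum_prod_two_rows {i j : ι} (hij : i ≠ j) (c : ι → κ → O → ℝ)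
    (hc : ∀ i k, ∑ o, c i k o = 1) (F : κ → O → O → ℝ) :
    ∑ y : ι → κ → O, (∏ i, ∏ k, c i k (y i k)) * ∏ k, F k (y i k) (y j k) =
      ∏ k, ∑ a, ∑ b, c i k a * c j k b * F k a b := by
  classical
  rw [sum_prod_pair hij (fun i (z : κ → O) => ∏ k, c i k (z k))
    (fun i => by rw [← Fintype.prod_sum]; simp [hc]) (fun a b => ∏ k, F k (a k) (b k))]
  simp only [← Finset.prod_mul_distrib]
  have : ∀ k, ∑ a, ∑ b, c i k a * c j k b * F k a b =
      ∑ q : O × O, c i k q.1 * c j k q.2 * F k q.1 q.2 := fun k => by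
    rw [Fintype.sum_prod_type]
  simp only [this]
  rw [Fintype.prod_sum, ← Fintype.sum_prod_type']
  exact Fintype.sum_equiv (Equiv.arrowProdEquivProdArrow κ (fun _ => O) (fun _ => O)).symm _ _
    fun a => rfl

/-- An exponential tail bound for a sum over the columns of a function of two rows, when the
entries are independent. -/
theorem massOf_two_rows_le {i j : ι} (hij : i ≠ j) {c : ι → κ → O → ℝ}
    (hc : ∀ i k, ∑ o, c i k o = 1) (hc0 : ∀ i k o, 0 ≤ c i k o) {Z : κ → O → O → ℝ}
    (hZ : ∀ k a b, |Z k a b| ≤ 1) {v : ℝ} (hv0 : 0 ≤ v) (hv : v ≤ 2)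
    (hm : ∑ k, ∑ a, ∑ b, c i k a * c j k b * Z k a b ≤ -(Fintype.card κ * v)) :
    massOf (fun y : ι → κ → O => ∏ i, ∏ k, c i k (y i k))
      (fun y => 0 ≤ ∑ k, Z k (y i k) (y j k)) ≤ Real.exp (-(Fintype.card κ * v ^ 2 / 4)) := by
  classical
  -- Markov's inequality for the exponential moment with parameter v/2, the minimiser of λ² - λv,
  -- whose minimum is -v²/4.
  have h1 : massOf (fun y : ι → κ → O => ∏ i, ∏ k, c i k (y i k))
      (fun y => 0 ≤ ∑ k, Z k (y i k) (y j k)) ≤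
      ∑ y : ι → κ → O, (∏ i, ∏ k, c i k (y i k)) *
        ∏ k, Real.exp (v / 2 * Z k (y i k) (y j k)) := by
    rw [massOf_eq_sum_ite]
    refine Finset.sum_le_sum fun y _ => ?_
    have hP : 0 ≤ ∏ i, ∏ k, c i k (y i k) :=
      Finset.prod_nonneg fun i _ => Finset.prod_nonneg fun k _ => hc0 _ _ _
    rw [← Real.exp_sum, ← Finset.mul_sum]
    split_ifs with h
    · refine le_mul_of_one_le_right hP (Real.one_le_exp (by positivity))
    · positivity
  refine h1.trans ?_
  rw [sum_prod_two_rows hij c hc (fun k a b => Real.exp (v / 2 * Z k a b))]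
  -- As v/2 ≤ 1, the exponent lies in [-1, 1], where exp x ≤ 1 + x + x².
  have h2 : ∀ k, ∑ a, ∑ b, c i k a * c j k b * Real.exp (v / 2 * Z k a b) ≤
      Real.exp (v / 2 * (∑ a, ∑ b, c i k a * c j k b * Z k a b) + (v / 2) ^ 2) := by
    intro k
    refine le_trans ?_ (Real.add_one_le_exp _)
    have h3 : ∀ a b, c i k a * c j k b * Real.exp (v / 2 * Z k a b) ≤
        c i k a * c j k b * (1 + (v / 2) ^ 2) + v / 2 * (c i k a * c j k b * Z k a b) := by
      intro a b
      have hcc := mul_nonneg (hc0 i k a) (hc0 j k b)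
      have hz : |v / 2 * Z k a b| ≤ v / 2 := by
        rw [abs_mul, abs_of_nonneg (by positivity : 0 ≤ v / 2)]
        exact mul_le_of_le_one_right (by positivity) (hZ k a b)
      have h4 := (abs_le.1 (Real.abs_exp_sub_one_sub_id_le (hz.trans (by linarith)))).2
      have h5 : (v / 2 * Z k a b) ^ 2 ≤ (v / 2) ^ 2 := sq_le_sq' (by linarith [(abs_le.1 hz).1])
        (abs_le.1 hz).2
      have : Real.exp (v / 2 * Z k a b) ≤ 1 + (v / 2) ^ 2 + v / 2 * Z k a b := by linarith
      calc _ ≤ c i k a * c j k b * (1 + (v / 2) ^ 2 + v / 2 * Z k a b) :=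
            mul_le_mul_of_nonneg_left this hcc
        _ = _ := by ring
    refine (Finset.sum_le_sum fun a _ => Finset.sum_le_sum fun b _ => h3 a b).trans ?_
    simp only [Finset.sum_add_distrib, ← Finset.sum_mul, ← Finset.mul_sum, hc]
    linarith
  refine (Finset.prod_le_prod (fun k _ => ?_) fun k _ => h2 k).trans ?_
  · exact Finset.sum_nonneg fun a _ => Finset.sum_nonneg fun b _ =>
      mul_nonneg (mul_nonneg (hc0 _ _ _) (hc0 _ _ _)) (Real.exp_pos _).le
  rw [← Real.exp_sum, Real.exp_le_exp, Finset.sum_add_distrib, ← Finset.mul_sum]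
  simp only [Finset.sum_const, Finset.card_univ, nsmul_eq_mul]
  nlinarith [mul_le_mul_of_nonneg_left hm (by positivity : 0 ≤ v / 2)]

end Weights
/-! ### The channel -/

section Channel

variable {p ε : ℝ}

theorem cascade_none (x : Bool) : cascade p ε x none = ε := by
  cases x <;> simp [cascade, bsc, erasureChannel] <;> ring

theorem cascade_some (x z : Bool) :
    cascade p ε x (some z) = if z = x then (1 - ε) * (1 - p) else (1 - ε) * p := by
  cases x <;> cases z <;> simp [cascade, bsc, erasureChannel] <;> ring

theorem sum_cascade (x : Bool) : ∑ o, cascade p ε x o = 1 := by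
  rw [Fintype.sum_option, Fintype.sum_bool]
  cases x <;> simp [cascade_none, cascade_some] <;> ring

theorem cascade_nonneg (hp : 0 ≤ p) (hp1 : p ≤ 1) (hε : 0 ≤ ε) (hε1 : ε ≤ 1) (x : Bool)
    (o : Option Bool) : 0 ≤ cascade p ε x o := by
  rcases o with _ | z
  · rwa [cascade_none]
  · rw [cascade_some]
    split_ifs <;> apply mul_nonneg <;> linarith

/-- This identifies p₁ as the Bhattacharyya coefficient of the two output laws, the only way in
which it enters either half of the theorem. -/
theorem sum_sqrt_cascade (hε : 0 ≤ ε) (hε1 : ε ≤ 1) (x : Bool) :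
    ∑ o, √(cascade p ε x o * cascade p ε (!x) o) = p1 p ε := by
  have h1 : √(ε * ε) = ε := Real.sqrt_mul_self hε
  have h2 : √((1 - ε) * (1 - p) * ((1 - ε) * p)) = (1 - ε) * √(p * (1 - p)) := by
    rw [show (1 - ε) * (1 - p) * ((1 - ε) * p) = (1 - ε) ^ 2 * (p * (1 - p)) by ring,
      Real.sqrt_mul (sq_nonneg _), Real.sqrt_sq (by linarith)]
  have h3 : √((1 - ε) * p * ((1 - ε) * (1 - p))) = (1 - ε) * √(p * (1 - p)) := by
    rw [mul_comm, h2]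
  rw [Fintype.sum_option, Fintype.sum_bool]
  cases x <;> simp [cascade_none, cascade_some, h1, h2, h3, p1] <;> ring

theorem obsProb_nonneg (hp : 0 ≤ p) (hp1 : p ≤ 1) (hε : 0 ≤ ε) (hε1 : ε ≤ 1) {m n : ℕ}
    (x : Ratings m n) (y : Observations m n) : 0 ≤ obsProb p ε x y :=
  Finset.prod_nonneg fun _ _ => Finset.prod_nonneg fun _ _ => cascade_nonneg hp hp1 hε hε1 _ _

theorem sum_obsProb {m n : ℕ} (x : Ratings m n) : ∑ y, obsProb p ε x y = 1 := by
  simp only [obsProb]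
  rw [sum_prod_prod (fun i k o => cascade p ε (x i k) o)]
  simp only [sum_cascade, Finset.prod_const_one]

/-- The contribution of a column to `disagreeCount - d₀ * commonCount`. -/
noncomputable def score (d₀ : ℝ) (a b : Option Bool) : ℝ :=
  if a ≠ none ∧ b ≠ none then (if a ≠ b then 1 else 0) - d₀ else 0

theorem abs_score_le {d₀ : ℝ} (h0 : 0 ≤ d₀) (h1 : d₀ ≤ 1) (a b : Option Bool) :
    |score d₀ a b| ≤ 1 := by
  unfold score
  split_ifs <;> rw [abs_le] <;> constructor <;> linarith

theorem sum_score {ι : Type} [Fintype ι] (d₀ : ℝ) (u v : ι → Option Bool) :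
    ∑ k, score d₀ (u k) (v k) = disagreeCount u v - d₀ * commonCount u v := by
  rw [disagreeCount, commonCount, Finset.card_filter, Finset.card_filter]
  push_cast
  rw [Finset.mul_sum, ← Finset.sum_sub_distrib]
  refine Finset.sum_congr rfl fun k _ => ?_
  by_cases h1 : u k = none <;> by_cases h2 : v k = none <;> by_cases h3 : u k = v k <;>
    simp [score, h1, h2, h3]

/-- Both entries survive with probability (1 - ε)², and exactly one of them is flipped with
probability 2p(1-p). -/
theorem mean_score (d₀ : ℝ) (x x' : Bool) :
    ∑ a, ∑ b, cascade p ε x a * cascade p ε x' b * score d₀ a b =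
      (1 - ε) ^ 2 * ((if x = x' then 2 * p * (1 - p) else 1 - 2 * p * (1 - p)) - d₀) := by
  simp only [Fintype.sum_option, Fintype.sum_bool]
  cases x <;> cases x' <;> simp [cascade_none, cascade_some, score] <;> ring

theorem sum_score_nonneg_of_le_hammingRatio {ι : Type} [Fintype ι] {d₀ : ℝ} (hd : 0 < d₀)
    {u v : ι → Option Bool} (h : d₀ ≤ hammingRatio u v) : 0 ≤ ∑ k, score d₀ (u k) (v k) := by
  rw [sum_score]
  unfold hammingRatio at h
  rcases Nat.eq_zero_or_pos (commonCount u v) with h0 | h0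
  · rw [h0] at h; simp at h; linarith
  · have : (0 : ℝ) < commonCount u v := by exact_mod_cast h0
    rw [le_div_iff₀ this] at h
    linarith

theorem sum_score_nonpos_of_hammingRatio_lt {ι : Type} [Fintype ι] {d₀ : ℝ}
    {u v : ι → Option Bool} (h : hammingRatio u v < d₀) : 0 ≤ ∑ k, -score d₀ (u k) (v k) := by
  rw [Finset.sum_neg_distrib, sum_score]
  unfold hammingRatio at h
  -- Without common columns the ratio is 0 by convention and the sum of scores vanishes, which the
  -- non-strict conclusion still allows.
  rcases Nat.eq_zero_or_pos (commonCount u v) with h0 | h0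
  · have : disagreeCount u v ≤ commonCount u v :=
      Finset.card_le_card fun k => by simp +contextual
    rw [h0] at this ⊢
    simp [Nat.le_zero.1 this]
  · have : (0 : ℝ) < commonCount u v := by exact_mod_cast h0
    rw [div_lt_iff₀ this] at h
    linarith

theorem massOf_le_hammingRatio_le (hp : 0 ≤ p) (hp1 : p ≤ 1) (hε : 0 ≤ ε) (hε1 : ε ≤ 1)
    {d₀ v : ℝ} (hd : 0 < d₀) (hd1 : d₀ ≤ 1) (hv0 : 0 ≤ v) (hv2 : v ≤ 2)
    (hv : v ≤ (1 - ε) ^ 2 * (d₀ - 2 * p * (1 - p))) {m n : ℕ} {x : Ratings m n}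
    {i j : Fin m} (hij : i ≠ j) (hx : x i = x j) :
    massOf (obsProb p ε x) (fun y => d₀ ≤ hammingRatio (y i) (y j)) ≤
      Real.exp (-(n * v ^ 2 / 4)) := by
  refine (massOf_mono (obsProb_nonneg hp hp1 hε hε1 x)
    fun y => sum_score_nonneg_of_le_hammingRatio hd).trans ?_
  have := massOf_two_rows_le (ι := Fin m) (κ := Fin n) hij
    (c := fun i k o => cascade p ε (x i k) o) (fun _ _ => sum_cascade _)
    (fun _ _ _ => cascade_nonneg hp hp1 hε hε1 _ _) (Z := fun _ a b => score d₀ a b)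
    (fun _ a b => abs_score_le hd.le hd1 a b) hv0 hv2 ?_
  · rwa [Fintype.card_fin] at this
  · simp only [mean_score, hx, if_true, Finset.sum_const, Finset.card_univ, nsmul_eq_mul,
      Fintype.card_fin]
    nlinarith [mul_le_mul_of_nonneg_left hv (Nat.cast_nonneg n : (0 : ℝ) ≤ n)]

theorem massOf_hammingRatio_lt_le (hp : 0 ≤ p) (hp1 : p ≤ 1) (hε : 0 ≤ ε) (hε1 : ε ≤ 1)
    {d₀ v η : ℝ} (hd : 0 < d₀) (hd1 : d₀ ≤ 1) (hη : 0 ≤ η) (hv0 : 0 ≤ v) (hv2 : v ≤ 2)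
    (hv : v ≤ (1 - ε) ^ 2 * (1 / 2 - η - d₀)) {m n : ℕ} {x : Ratings m n}
    {i j : Fin m} (hij : i ≠ j)
    (hx : (1 / 2 - η) * n ≤ ((Finset.univ.filter fun k => x i k ≠ x j k).card : ℝ)) :
    massOf (obsProb p ε x) (fun y => hammingRatio (y i) (y j) < d₀) ≤
      Real.exp (-(n * v ^ 2 / 4)) := by
  refine (massOf_mono (obsProb_nonneg hp hp1 hε hε1 x)
    fun y => sum_score_nonpos_of_hammingRatio_lt).trans ?_
  have := massOf_two_rows_le (ι := Fin m) (κ := Fin n) hij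
    (c := fun i k o => cascade p ε (x i k) o) (fun _ _ => sum_cascade _)
    (fun _ _ _ => cascade_nonneg hp hp1 hε hε1 _ _) (Z := fun _ a b => -score d₀ a b)
    (fun _ a b => by rw [abs_neg]; exact abs_score_le hd.le hd1 a b) hv0 hv2 ?_
  · rwa [Fintype.card_fin] at this
  · simp only [mul_neg, Finset.sum_neg_distrib, mean_score, Fintype.card_fin]
    rw [neg_le_neg_iff, ← Finset.mul_sum, Finset.sum_sub_distrib]
    set D : ℝ := ((Finset.univ.filter fun k => x i k ≠ x j k).card : ℝ) with hD
    have hs : ∑ k, (if x i k = x j k then 2 * p * (1 - p) else 1 - 2 * p * (1 - p)) =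
        n * (2 * p * (1 - p)) + D * (1 - 4 * p * (1 - p)) := by
      have : ∀ k, (if x i k = x j k then 2 * p * (1 - p) else 1 - 2 * p * (1 - p)) =
          2 * p * (1 - p) + (if x i k ≠ x j k then 1 else 0) * (1 - 4 * p * (1 - p)) := by
        intro k
        by_cases h : x i k = x j k <;> simp [h]; ring
      simp only [this, Finset.sum_add_distrib, ← Finset.sum_mul, hD, Finset.card_filter]
      simp [mul_assoc]
    rw [hs]
    simp only [Finset.sum_const, Finset.card_univ, nsmul_eq_mul, Fintype.card_fin]
    have hn : (0 : ℝ) ≤ n := Nat.cast_nonneg n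
    have h4 : 0 ≤ 1 - 4 * p * (1 - p) := by nlinarith [sq_nonneg (1 - 2 * p)]
    have h5 : 1 - 4 * p * (1 - p) ≤ 1 := by nlinarith
    have h6 := mul_le_mul_of_nonneg_right hx h4
    -- If exactly half of the columns differed, the expected disagreement rate would be 1/2 whatever
    -- p is. A deficit of η costs η(1 - 4p(1-p)), at most η.
    have h7 : n * (1 / 2 - η - d₀) ≤
        n * (2 * p * (1 - p)) + D * (1 - 4 * p * (1 - p)) - n * d₀ := by
      have : η * n * (1 - 4 * p * (1 - p)) ≤ η * n * 1 :=
        mul_le_mul_of_nonneg_left h5 (by positivity)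
      nlinarith
    calc n * v ≤ n * ((1 - ε) ^ 2 * (1 / 2 - η - d₀)) := mul_le_mul_of_nonneg_left hv hn
      _ = (1 - ε) ^ 2 * (n * (1 / 2 - η - d₀)) := by ring
      _ ≤ _ := mul_le_mul_of_nonneg_left h7 (sq_nonneg _)

/-- For p ≤ 1/2 majority is maximum likelihood: the likelihood depends only on the number of
erasures and on the two vote counts. -/
theorem prod_cascade_le (hp : 0 ≤ p) (hp2 : p ≤ 1 / 2) (hε : 0 ≤ ε) (hε1 : ε ≤ 1) {γ : Type*}
    (S : Finset γ) (y : γ → Option Bool) (v : Bool)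
    (h : (S.filter fun e => y e = some v).card ≤ (S.filter fun e => y e = some (!v)).card) :
    ∏ e ∈ S, cascade p ε v (y e) ≤ ∏ e ∈ S, cascade p ε (!v) (y e) := by
  have key : ∀ u v : Bool, (u = v ∨ u = !v) → ∏ e ∈ S, cascade p ε u (y e) =
      (∏ e ∈ S, if y e = none then ε else 1) *
      (if u = v then (1 - ε) * (1 - p) else (1 - ε) * p) ^
        (S.filter fun e => y e = some v).card *
      (if u = v then (1 - ε) * p else (1 - ε) * (1 - p)) ^
        (S.filter fun e => y e = some (!v)).card := by
    intro u v huv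
    rw [← Finset.prod_const, ← Finset.prod_const, Finset.prod_filter, Finset.prod_filter,
      ← Finset.prod_mul_distrib, ← Finset.prod_mul_distrib]
    refine Finset.prod_congr rfl fun e _ => ?_
    rcases y e with _ | z
    · simp [cascade_none]
    · rw [cascade_some]
      cases u <;> cases v <;> cases z <;> simp
  rw [key v v (Or.inl rfl), key (!v) v (Or.inr rfl)]
  simp only [if_true, Bool.not_eq_self, if_false, mul_assoc]
  refine mul_le_mul_of_nonneg_left ?_ (Finset.prod_nonneg fun e _ => by split_ifs <;> linarith)
  have hA : 0 ≤ (1 - ε) * p := mul_nonneg (by linarith) hp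
  have hAB : (1 - ε) * p ≤ (1 - ε) * (1 - p) := mul_le_mul_of_nonneg_left (by linarith)
    (by linarith)
  obtain ⟨d, hd⟩ := Nat.exists_eq_add_of_le h
  rw [hd, pow_add, pow_add]
  have h1 := pow_le_pow_left₀ hA hAB d
  have h2 : 0 ≤ ((1 - ε) * (1 - p)) ^ (S.filter fun e => y e = some v).card *
      ((1 - ε) * p) ^ (S.filter fun e => y e = some v).card := by
    have := hA.trans hAB
    positivity
  nlinarith [mul_le_mul_of_nonneg_left h1 h2]

/-- The Bhattacharyya bound for a tie or a wrong majority among the entries of `S`. -/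
theorem massOf_majority_le (hp : 0 ≤ p) (hp2 : p ≤ 1 / 2) (hε : 0 ≤ ε) (hε1 : ε ≤ 1) {m n : ℕ}
    (x : Ratings m n) (S : Finset (Fin m × Fin n)) (v : Bool) (hS : ∀ e ∈ S, x e.1 e.2 = v) :
    massOf (obsProb p ε x) (fun y => (S.filter fun e => y e.1 e.2 = some v).card ≤
      (S.filter fun e => y e.1 e.2 = some (!v)).card) ≤ p1 p ε ^ S.card := by
  classical
  -- On the event the likelihood of v over S is at most that of the opposite value, hence at most
  -- the geometric mean of both. Outside S the true law is kept and sums to one.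
  let f (i : Fin m) (k : Fin n) (o : Option Bool) : ℝ :=
    if (i, k) ∈ S then √(cascade p ε v o * cascade p ε (!v) o) else cascade p ε (x i k) o
  have hc := fun x o => cascade_nonneg hp (by linarith : p ≤ 1) hε hε1 x o
  have hf : ∀ i k o, 0 ≤ f i k o := by
    intro i k o
    simp only [f]
    split_ifs
    exacts [Real.sqrt_nonneg _, hc _ _]
  have h1 : massOf (obsProb p ε x) (fun y => (S.filter fun e => y e.1 e.2 = some v).card ≤
      (S.filter fun e => y e.1 e.2 = some (!v)).card) ≤
      ∑ y : Observations m n, ∏ i, ∏ k, f i k (y i k) := by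
    rw [massOf_eq_sum_ite]
    refine Finset.sum_le_sum fun y _ => ?_
    split_ifs with h
    · rw [obsProb, ← Fintype.prod_prod_type', ← Fintype.prod_prod_type',
        ← Finset.prod_mul_prod_compl S, ← Finset.prod_mul_prod_compl S]
      have e1 : ∏ e ∈ Sᶜ, f e.1 e.2 (y e.1 e.2) =
          ∏ e ∈ Sᶜ, cascade p ε (x e.1 e.2) (y e.1 e.2) :=
        Finset.prod_congr rfl fun e he => by simp [f, Finset.mem_compl.1 he]
      have e2 : ∏ e ∈ S, f e.1 e.2 (y e.1 e.2) =
          √((∏ e ∈ S, cascade p ε v (y e.1 e.2)) * ∏ e ∈ S, cascade p ε (!v) (y e.1 e.2)) := by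
        rw [← Finset.prod_mul_distrib, Real.sqrt_prod _ fun e _ => mul_nonneg (hc _ _) (hc _ _)]
        exact Finset.prod_congr rfl fun e he => by simp [f, he]
      have e3 : ∏ e ∈ S, cascade p ε (x e.1 e.2) (y e.1 e.2) =
          ∏ e ∈ S, cascade p ε v (y e.1 e.2) :=
        Finset.prod_congr rfl fun e he => by rw [hS e he]
      rw [e1, e2, e3]
      refine mul_le_mul_of_nonneg_right ?_ (Finset.prod_nonneg fun e _ => hc _ _)
      have := prod_cascade_le hp hp2 hε hε1 S (fun e => y e.1 e.2) v h
      have h0 : 0 ≤ ∏ e ∈ S, cascade p ε v (y e.1 e.2) := Finset.prod_nonneg fun e _ => hc _ _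
      exact Real.le_sqrt_of_sq_le (by nlinarith)
    · exact Finset.prod_nonneg fun i _ => Finset.prod_nonneg fun k _ => hf _ _ _
  refine h1.trans (le_of_eq ?_)
  rw [sum_prod_prod f, ← Fintype.prod_prod_type', ← Finset.prod_mul_prod_compl S]
  have e1 : ∏ e ∈ S, ∑ o, f e.1 e.2 o = p1 p ε ^ S.card := by
    rw [← Finset.prod_const]
    refine Finset.prod_congr rfl fun e he => ?_
    simp only [f, Prod.mk.eta, he, if_true]
    exact sum_sqrt_cascade hε hε1 v
  have e2 : ∏ e ∈ Sᶜ, ∑ o, f e.1 e.2 o = 1 := by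
    refine Finset.prod_eq_one fun e he => ?_
    simp only [f, Prod.mk.eta, Finset.mem_compl.1 he, if_false]
    exact sum_cascade _
  rw [e1, e2, mul_one]

end Channel
/-! ### Error events of the estimator -/

theorem PMF.sum_toReal {α : Type*} [Fintype α] (μ : PMF α) : ∑ x, (μ x).toReal = 1 := by
  rw [← ENNReal.toReal_sum fun x _ => μ.apply_ne_top x, ← tsum_fintype (L := .unconditional _),
    μ.tsum_coe, ENNReal.toReal_one]

namespace BlockModel

variable (M : BlockModel) {p ε : ℝ}

/-- Exchange of rows and columns. -/
def flip : BlockModel where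
  m := M.n
  n := M.m
  r := M.t
  t := M.r
  m₀ := M.n₀
  n₀ := M.m₀
  m_pos := M.n_pos
  n_pos := M.m_pos
  row := M.col
  col := M.row
  card_row := M.card_col
  card_col := M.card_row

theorem n₀_pos : 0 < M.n₀ := by
  rw [← M.card_col (M.col ⟨0, M.n_pos⟩)]
  exact Finset.card_pos.2 ⟨⟨0, M.n_pos⟩, by simp⟩

theorem m₀_pos : 0 < M.m₀ := M.flip.n₀_pos

theorem card_filter_col (B : Finset (Fin M.t)) :
    (Finset.univ.filter fun k => M.col k ∈ B).card = B.card * M.n₀ := by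
  rw [Finset.card_eq_sum_card_fiberwise (f := M.col) (t := B) (fun k hk => by simpa using hk),
    ← smul_eq_mul, ← Finset.sum_const]
  refine Finset.sum_congr rfl fun b hb => ?_
  rw [← M.card_col b]
  congr 1
  ext k
  simp only [Finset.mem_filter, Finset.mem_univ, true_and, and_iff_right_iff_imp]
  rintro rfl
  exact hb

theorem n_eq : M.n = M.t * M.n₀ := by
  have := M.card_filter_col Finset.univ
  simpa using this

theorem m_eq : M.m = M.r * M.m₀ := M.flip.n_eq

/-- The joint law of the cluster values and the observations. -/
noncomputable def joint (p ε : ℝ)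
    (a : (Fin M.r → Fin M.t → Bool) × Observations M.m M.n) : ℝ :=
  (1 / 2 : ℝ) ^ (M.r * M.t) * obsProb p ε (M.expand a.1) a.2

theorem joint_nonneg (hp : 0 ≤ p) (hp1 : p ≤ 1) (hε : 0 ≤ ε) (hε1 : ε ≤ 1)
    (a : (Fin M.r → Fin M.t → Bool) × Observations M.m M.n) : 0 ≤ M.joint p ε a :=
  mul_nonneg (by positivity) (obsProb_nonneg hp hp1 hε hε1 _ _)

theorem sum_uniform : ∑ _w : Fin M.r → Fin M.t → Bool, (1 / 2 : ℝ) ^ (M.r * M.t) = 1 := by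
  simp only [Finset.sum_const, Finset.card_univ, nsmul_eq_mul, Fintype.card_fun, Fintype.card_bool,
    Fintype.card_fin]
  push_cast
  rw [← pow_mul, mul_comm M.t, ← mul_pow]
  norm_num

/-- The rows `i` and `j` are wrongly separated or wrongly put into the same cluster. -/
def RowError (d₀ : ℝ) (i j : Fin M.m)
    (a : (Fin M.r → Fin M.t → Bool) × Observations M.m M.n) : Prop :=
  ¬(j ∈ estCluster d₀ a.2 i ↔ M.row i = M.row j)

/-- The cluster `(b, c)` as a set of entries. -/
def block (b : Fin M.r) (c : Fin M.t) : Finset (Fin M.m × Fin M.n) :=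
  (Finset.univ.filter fun i => M.row i = b) ×ˢ (Finset.univ.filter fun k => M.col k = c)

/-- There is a tie or a wrong majority in the cluster `(b, c)`. -/
def BlockError (b : Fin M.r) (c : Fin M.t)
    (a : (Fin M.r → Fin M.t → Bool) × Observations M.m M.n) : Prop :=
  ((M.block b c).filter fun e => a.2 e.1 e.2 = some (a.1 b c)).card ≤
    ((M.block b c).filter fun e => a.2 e.1 e.2 = some (!a.1 b c)).card

/-- The values and the observations of the transposed model. -/
def flipEquiv : (Fin M.r → Fin M.t → Bool) × Observations M.m M.n ≃
    (Fin M.flip.r → Fin M.flip.t → Bool) × Observations M.flip.m M.flip.n :=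
  (Equiv.piComm fun _ _ => Bool).prodCongr (Equiv.piComm fun _ _ => Option Bool)

/-- The model is symmetric under transposition, so column errors are row errors of `flip`. -/
theorem joint_flipEquiv (a : (Fin M.r → Fin M.t → Bool) × Observations M.m M.n) :
    M.joint p ε a = M.flip.joint p ε (M.flipEquiv a) := by
  have h : obsProb p ε (M.expand a.1) a.2 =
      obsProb p ε (M.flip.expand (M.flipEquiv a).1) (M.flipEquiv a).2 := Finset.prod_comm
  rw [joint, joint, h, show M.flip.r * M.flip.t = M.r * M.t from mul_comm _ _]

/-- Without row and column errors the estimated clusters are the true ones. Ties count as block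
errors, so the remaining majorities are strict and τ plays no role. -/
theorem clusterMajority_eq {d₀ : ℝ} {a : (Fin M.r → Fin M.t → Bool) × Observations M.m M.n}
    (hr : ∀ i j, ¬M.RowError d₀ i j a) (hc : ∀ k l, ¬M.flip.RowError d₀ k l (M.flipEquiv a))
    (hb : ∀ b c, ¬M.BlockError b c a) (τ : Fin M.m → Fin M.n → Bool) :
    clusterMajority d₀ τ a.2 = M.expand a.1 := by
  funext i k
  have h1 : estCluster d₀ a.2 i = Finset.univ.filter fun j => M.row j = M.row i := by
    ext j
    have := not_not.1 (hr i j)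
    simp [this, eq_comm]
  have h2 : estCluster d₀ (flipObs a.2) k = Finset.univ.filter fun l => M.col l = M.col k := by
    ext l
    have : l ∈ estCluster d₀ (flipObs a.2) k ↔ M.col k = M.col l := not_not.1 (hc k l)
    simp [this, eq_comm]
  have h3 : ∀ z, votes d₀ a.2 i k z = ((M.block (M.row i) (M.col k)).filter
      fun e => a.2 e.1 e.2 = some z).card := by
    intro z
    rw [votes, h1, h2, block]
  have h4 := hb (M.row i) (M.col k)
  rw [BlockError, not_le, ← h3, ← h3] at h4
  rw [clusterMajority, expand]
  cases hw : a.1 (M.row i) (M.col k) <;> simp only [hw, Bool.not_true, Bool.not_false] at h4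
  · exact if_pos h4
  · rw [if_neg (not_lt.2 h4.le), if_pos h4]

/-- Off the error events the output is right for every τ, so the bound holds for any law of the
tie-breaking bits. -/
theorem avgError_le_massOf (hp : 0 ≤ p) (hp1 : p ≤ 1) (hε : 0 ≤ ε) (hε1 : ε ≤ 1) {d₀ : ℝ}
    (κ : PMF (Fin M.m → Fin M.n → Bool)) :
    M.avgError p ε (clusterMajorityEstimator d₀ κ) ≤ massOf (M.joint p ε) fun a =>
      (∃ i j, M.RowError d₀ i j a) ∨ (∃ k l, M.flip.RowError d₀ k l (M.flipEquiv a)) ∨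
        ∃ b c, M.BlockError b c a := by
  classical
  rw [avgError, massOf_eq_sum_ite, Fintype.sum_prod_type]
  refine Finset.sum_le_sum fun w _ => ?_
  rw [Finset.mul_sum]
  refine Finset.sum_le_sum fun y _ => ?_
  rw [← mul_assoc]
  change M.joint p ε (w, y) * _ ≤ _
  have hj := M.joint_nonneg hp hp1 hε hε1 (w, y)
  split_ifs with h
  · refine mul_le_of_le_one_right hj ?_
    rw [← PMF.sum_toReal (clusterMajorityEstimator d₀ κ y)]
    exact Finset.sum_le_sum_of_subset_of_nonneg (Finset.filter_subset _ _)
      fun _ _ _ => ENNReal.toReal_nonneg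
  · simp only [not_or, not_exists] at h
    refine (mul_eq_zero_of_right _ (Finset.sum_eq_zero fun x' hx' => ?_)).le
    have hx := (Finset.mem_filter.1 hx').2
    rw [clusterMajorityEstimator, PMF.map_apply, ENNReal.tsum_eq_zero.2, ENNReal.toReal_zero]
    intro τ
    rw [if_neg]
    rw [M.clusterMajority_eq (a := (w, y)) h.1 h.2.1 h.2.2 τ]
    exact hx

theorem massOf_few_differences_le {b c : Fin M.r} (hbc : b ≠ c) {η : ℝ} (hη : 0 ≤ η)
    (hη2 : η ≤ 1 / 2) :
    massOf (fun _ : Fin M.r → Fin M.t → Bool => (1 / 2 : ℝ) ^ (M.r * M.t))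
      (fun w => ((Finset.univ.filter fun k => w b k ≠ w c k).card : ℝ) < (1 / 2 - η) * M.t) ≤
      Real.exp (-(M.t * η ^ 2 / 4)) := by
  -- The tail bound for two rows is reused with the fair cluster values as entries. The summand is
  -- the indicator of agreement minus 1/2 + η, with mean -η.
  have := massOf_two_rows_le (ι := Fin M.r) (κ := Fin M.t) (O := Bool) hbc
    (c := fun _ _ _ => 1 / 2) (by intro _ _; norm_num) (fun _ _ _ => by norm_num)
    (Z := fun _ a b => (if a ≠ b then 0 else 1) - 1 / 2 - η) ?_ hη (by linarith) ?_
  · simp only [Finset.prod_const, Finset.card_univ, Fintype.card_fin, ← pow_mul] at this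
    rw [mul_comm M.t] at this
    refine (massOf_mono (fun _ => by positivity) fun w hw => ?_).trans this
    have : ∑ k, ((if w b k ≠ w c k then (0 : ℝ) else 1) - 1 / 2 - η) =
        (1 / 2 - η) * M.t - (Finset.univ.filter fun k => w b k ≠ w c k).card := by
      have h : ∀ k, ((if w b k ≠ w c k then (0 : ℝ) else 1) - 1 / 2 - η) =
          (1 / 2 - η) - (if w b k ≠ w c k then 1 else 0) := by
        intro k; split_ifs <;> ring
      simp only [h, Finset.sum_sub_distrib (f := fun _ => 1 / 2 - η), Finset.card_filter]
      push_cast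
      simp
      ring
    rw [this]
    linarith
  · intro _ a b
    rw [abs_le]
    split_ifs <;> constructor <;> linarith
  · simp only [Fintype.sum_bool, Finset.sum_const, Finset.card_univ, nsmul_eq_mul]
    apply le_of_eq
    simp
    ring

/-- The argument conditions on the cluster values. Rows of one cluster always have equal values; for
rows of different clusters the rare values with few differences are split off first. -/
theorem massOf_rowError_le (hp : 0 ≤ p) (hp1 : p ≤ 1) (hε : 0 ≤ ε) (hε1 : ε ≤ 1)
    {d₀ v η : ℝ} (hd : 0 < d₀) (hd1 : d₀ ≤ 1) (hη : 0 ≤ η) (hη2 : η ≤ 1 / 2) (hv0 : 0 ≤ v)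
    (hv2 : v ≤ 2) (hv : v ≤ (1 - ε) ^ 2 * (d₀ - 2 * p * (1 - p)))
    (hv' : v ≤ (1 - ε) ^ 2 * (1 / 2 - η - d₀)) (i j : Fin M.m) :
    massOf (M.joint p ε) (M.RowError d₀ i j) ≤
      Real.exp (-(M.n * v ^ 2 / 4)) + Real.exp (-(M.t * η ^ 2 / 4)) := by
  classical
  have hav : ∀ f : (Fin M.r → Fin M.t → Bool) → ℝ, (∀ w, f w ≤ Real.exp (-(M.n * v ^ 2 / 4))) →
      ∑ w, (1 / 2 : ℝ) ^ (M.r * M.t) * f w ≤ Real.exp (-(M.n * v ^ 2 / 4)) := by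
    intro f hf
    calc _ ≤ ∑ w : Fin M.r → Fin M.t → Bool,
          (1 / 2 : ℝ) ^ (M.r * M.t) * Real.exp (-(M.n * v ^ 2 / 4)) :=
        Finset.sum_le_sum fun w _ => mul_le_mul_of_nonneg_left (hf w) (by positivity)
      _ = _ := by rw [← Finset.sum_mul, sum_uniform, one_mul]
  have hP := obsProb_nonneg hp hp1 hε hε1 (m := M.m) (n := M.n)
  have hsplit : ∀ E, massOf (M.joint p ε) E = ∑ w, (1 / 2 : ℝ) ^ (M.r * M.t) *
      massOf (obsProb p ε (M.expand w)) (fun y => E (w, y)) := fun E =>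
    massOf_prod (fun _ => (1 / 2 : ℝ) ^ (M.r * M.t)) (fun w => obsProb p ε (M.expand w)) E
  by_cases hrow : M.row i = M.row j
  · refine le_add_of_le_of_nonneg ?_ (Real.exp_pos _).le
    rw [hsplit]
    refine hav _ fun w => ?_
    by_cases hij : i = j
    · subst hij
      have : ∀ y, ¬M.RowError d₀ i i (w, y) := by
        intro y
        have : disagreeCount (y i) (y i) = 0 := by simp [disagreeCount]
        simp [RowError, mem_estCluster, hammingRatio, this, hd]
      rw [massOf_eq_sum_ite, Finset.sum_eq_zero fun y _ => if_neg (this y)]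
      exact (Real.exp_pos _).le
    · refine (massOf_mono (hP _) fun y hy => ?_).trans
        (massOf_le_hammingRatio_le hp hp1 hε hε1 hd hd1 hv0 hv2 hv hij (x := M.expand w) ?_)
      · simpa [RowError, hrow, mem_estCluster] using hy
      · funext k
        rw [expand, expand, hrow]
  · let few (w : Fin M.r → Fin M.t → Bool) : Prop :=
      ((Finset.univ.filter fun k => w (M.row i) k ≠ w (M.row j) k).card : ℝ) <
        (1 / 2 - η) * M.t
    refine (massOf_mono (M.joint_nonneg hp hp1 hε hε1)
      (F := fun a => (¬few a.1 ∧ M.RowError d₀ i j a) ∨ few a.1) fun a ha => by tauto).trans ?_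
    refine (massOf_or_le (M.joint_nonneg hp hp1 hε hε1) _ _).trans (add_le_add ?_ ?_)
    · rw [hsplit]
      refine hav _ fun w => ?_
      by_cases hw : few w
      · simp only [hw, not_true_eq_false, false_and]
        rw [massOf_eq_sum_ite]
        simpa using (Real.exp_pos _).le
      · refine (massOf_mono (hP _) fun y hy => ?_).trans
          (massOf_hammingRatio_lt_le hp hp1 hε hε1 hd hd1 hη hv0 hv2 hv' (i := i) (j := j)
            (fun h => hrow (h ▸ rfl)) (x := M.expand w) ?_)
        · simpa [RowError, hrow, mem_estCluster] using hy.2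
        · have h := M.card_filter_col (Finset.univ.filter fun k => w (M.row i) k ≠ w (M.row j) k)
          simp only [Finset.mem_filter, Finset.mem_univ, true_and] at h
          change _ ≤ (((Finset.univ.filter fun k =>
            w (M.row i) (M.col k) ≠ w (M.row j) (M.col k)).card : ℕ) : ℝ)
          rw [h, M.n_eq]
          push_cast
          rw [← mul_assoc]
          exact mul_le_mul_of_nonneg_right (not_lt.1 hw) (Nat.cast_nonneg _)
    · rw [hsplit]
      refine le_trans (le_of_eq ?_) (M.massOf_few_differences_le hrow hη hη2)
      rw [massOf_eq_sum_ite]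
      refine Finset.sum_congr rfl fun w _ => ?_
      rw [massOf_eq_sum_ite]
      change _ = if few w then _ else _
      split_ifs with hw
      · rw [sum_obsProb, mul_one]
      · simp

theorem card_block (b : Fin M.r) (c : Fin M.t) : (M.block b c).card = M.m₀ * M.n₀ := by
  rw [block, Finset.card_product, M.card_row, M.card_col]

theorem massOf_blockError_le (hp : 0 ≤ p) (hp2 : p ≤ 1 / 2) (hε : 0 ≤ ε) (hε1 : ε ≤ 1)
    (b : Fin M.r) (c : Fin M.t) :
    massOf (M.joint p ε) (M.BlockError b c) ≤ p1 p ε ^ (M.m₀ * M.n₀) := by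
  have h : ∀ w : Fin M.r → Fin M.t → Bool, massOf (obsProb p ε (M.expand w))
      (fun y => M.BlockError b c (w, y)) ≤ p1 p ε ^ (M.m₀ * M.n₀) := by
    intro w
    rw [← M.card_block b c]
    refine massOf_majority_le hp hp2 hε hε1 (M.expand w) (M.block b c) (w b c) fun e he => ?_
    simp only [block, Finset.mem_product, Finset.mem_filter, Finset.mem_univ, true_and] at he
    rw [expand, he.1, he.2]
  calc _ = ∑ w, (1 / 2 : ℝ) ^ (M.r * M.t) *
        massOf (obsProb p ε (M.expand w)) (fun y => M.BlockError b c (w, y)) :=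
      massOf_prod (fun _ => (1 / 2 : ℝ) ^ (M.r * M.t)) (fun w => obsProb p ε (M.expand w)) _
    _ ≤ ∑ w : Fin M.r → Fin M.t → Bool, (1 / 2 : ℝ) ^ (M.r * M.t) * p1 p ε ^ (M.m₀ * M.n₀) :=
      Finset.sum_le_sum fun w _ => mul_le_mul_of_nonneg_left (h w) (by positivity)
    _ = _ := by rw [← Finset.sum_mul, sum_uniform, one_mul]

theorem avgError_clusterMajority_le (hp : 0 ≤ p) (hp2 : p ≤ 1 / 2) (hε : 0 ≤ ε) (hε1 : ε ≤ 1)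
    {d₀ v η : ℝ} (hd : 0 < d₀) (hd1 : d₀ ≤ 1) (hη : 0 ≤ η) (hη2 : η ≤ 1 / 2) (hv0 : 0 ≤ v)
    (hv2 : v ≤ 2) (hv : v ≤ (1 - ε) ^ 2 * (d₀ - 2 * p * (1 - p)))
    (hv' : v ≤ (1 - ε) ^ 2 * (1 / 2 - η - d₀)) (κ : PMF (Fin M.m → Fin M.n → Bool)) :
    M.avgError p ε (clusterMajorityEstimator d₀ κ) ≤
      (M.m : ℝ) ^ 2 * (Real.exp (-(M.n * v ^ 2 / 4)) + Real.exp (-(M.t * η ^ 2 / 4))) +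
      (M.n : ℝ) ^ 2 * (Real.exp (-(M.m * v ^ 2 / 4)) + Real.exp (-(M.r * η ^ 2 / 4))) +
      M.r * M.t * p1 p ε ^ (M.m₀ * M.n₀) := by
  have hp1 : p ≤ 1 := by linarith
  have hJ := M.joint_nonneg hp hp1 hε hε1
  have two : ∀ (ι κ : Type) [Fintype ι] [Fintype κ]
      (E : ι → κ → (Fin M.r → Fin M.t → Bool) × Observations M.m M.n → Prop) (c : ℝ),
      (∀ i j, massOf (M.joint p ε) (E i j) ≤ c) →
      massOf (M.joint p ε) (fun a => ∃ i j, E i j a) ≤ Fintype.card ι * Fintype.card κ * c := by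
    intro ι κ _ _ E c h
    refine (massOf_exists_le hJ fun i a => ∃ j, E i j a).trans ?_
    refine (Finset.sum_le_sum fun i _ => (massOf_exists_le hJ (E i)).trans
      (Finset.sum_le_sum fun j _ => h i j)).trans ?_
    simp [mul_assoc]
  refine (M.avgError_le_massOf hp hp1 hε hε1 κ).trans ?_
  refine (massOf_or_le hJ _ _).trans ?_
  rw [add_assoc]
  refine add_le_add ?_ ((massOf_or_le hJ _ _).trans (add_le_add ?_ ?_))
  · refine (two _ _ (M.RowError d₀) _ fun i j =>
      M.massOf_rowError_le hp hp1 hε hε1 hd hd1 hη hη2 hv0 hv2 hv hv' i j).trans (le_of_eq ?_)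
    rw [Fintype.card_fin, sq (M.m : ℝ)]
  · refine (two _ _ (fun k l a => M.flip.RowError d₀ k l (M.flipEquiv a))
      (Real.exp (-(M.m * v ^ 2 / 4)) + Real.exp (-(M.r * η ^ 2 / 4))) fun k l => ?_).trans
      (le_of_eq ?_)
    · rw [massOf_equiv M.flipEquiv M.joint_flipEquiv (M.flip.RowError d₀ k l)]
      exact M.flip.massOf_rowError_le hp hp1 hε hε1 hd hd1 hη hη2 hv0 hv2 hv hv' k l
    · rw [Fintype.card_fin, sq (M.n : ℝ)]
      rfl
  · refine (two _ _ M.BlockError _ fun b c =>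
      M.massOf_blockError_le hp hp2 hε hε1 b c).trans (le_of_eq ?_)
    rw [Fintype.card_fin, Fintype.card_fin]

end BlockModel
/-! ### Achievability -/

theorem p1_nonneg {p ε : ℝ} (hε : 0 ≤ ε) (hε1 : ε ≤ 1) : 0 ≤ p1 p ε :=
  add_nonneg hε (mul_nonneg (by linarith) (Real.sqrt_nonneg _))

theorem p1_lt_one {p ε : ℝ} (hp2 : p < 1 / 2) (hε1 : ε < 1) : p1 p ε < 1 := by
  have : √(p * (1 - p)) < 1 / 2 := by
    rw [Real.sqrt_lt' (by norm_num)]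
    nlinarith [sq_pos_of_pos (by linarith : 0 < 1 - 2 * p)]
  unfold p1
  nlinarith [mul_lt_mul_of_pos_left this (by linarith : 0 < 1 - ε)]

theorem eventually_le_mul_of_limsup_div_lt_top {a b : ℕ → ℕ} (hb : ∀ k, 0 < b k)
    (h : limsup (fun k => (a k : ℝ≥0∞) / (b k : ℝ≥0∞)) atTop < ⊤) :
    ∃ A : ℝ, 0 < A ∧ ∀ᶠ k in atTop, (a k : ℝ) ≤ A * b k := by
  obtain ⟨A, hA, hA'⟩ := ENNReal.lt_iff_exists_nnreal_btwn.1 h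
  refine ⟨A, NNReal.coe_pos.2 (ENNReal.coe_pos.1 (pos_of_gt hA)), ?_⟩
  filter_upwards [eventually_lt_of_limsup_lt hA] with k hk
  have hk' := (ENNReal.div_le_iff (by simpa using (hb k).ne') (by simp)).1 hk.le
  exact_mod_cast hk'

/-- From a ≤ A b follows ab ≤ A b², which stays bounded when b does. -/
theorem tendsto_atTop_of_mul_of_le {a b : ℕ → ℕ} {A : ℝ}
    (h : Tendsto (fun k => a k * b k) atTop atTop) (hA : ∀ᶠ k in atTop, (a k : ℝ) ≤ A * b k) :
    Tendsto b atTop atTop := by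
  rw [tendsto_atTop]
  intro B
  obtain ⟨N, hN⟩ := exists_nat_gt (A * B ^ 2)
  filter_upwards [hA, h.eventually_ge_atTop (N + 1)] with k hk hk'
  by_contra! hlt
  have h1 : (b k : ℝ) ≤ B := by exact_mod_cast hlt.le
  have h2 : (N : ℝ) + 1 ≤ a k * b k := by exact_mod_cast hk'
  have h0 : (0 : ℝ) ≤ b k := Nat.cast_nonneg _
  have h3 : (a k : ℝ) * b k ≤ A * b k * b k := mul_le_mul_of_nonneg_right hk h0
  have hA0 : 0 ≤ A := by
    by_contra! hneg
    have : A * (b k : ℝ) * b k ≤ 0 := by nlinarith [mul_nonneg h0 h0]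
    linarith [Nat.cast_nonneg (α := ℝ) N]
  have h4 : A * (b k : ℝ) * b k ≤ A * B ^ 2 := by
    rw [mul_assoc, ← sq]
    exact mul_le_mul_of_nonneg_left (pow_le_pow_left₀ h0 h1 2) hA0
  linarith

/-- With Cη² = 12 the second exponential is at most b⁻³, which beats a² ≤ A²b². For the first, any
fixed v > 0 suffices. -/
theorem tendsto_sq_mul_exp_add_exp {a b t : ℕ → ℕ} {A v η C : ℝ} (hA0 : 0 < A)
    (hb : Tendsto b atTop atTop) (hA : ∀ᶠ k in atTop, (a k : ℝ) ≤ A * b k)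
    (ht : ∀ᶠ k in atTop, C * Real.log (b k) ≤ t k) (hv : 0 < v) (hC : C * η ^ 2 = 12) :
    Tendsto (fun k => (a k : ℝ) ^ 2 *
      (Real.exp (-(b k * v ^ 2 / 4)) + Real.exp (-(t k * η ^ 2 / 4)))) atTop (𝓝 0) := by
  have hbR : Tendsto (fun k => (b k : ℝ)) atTop atTop := tendsto_natCast_atTop_atTop.comp hb
  have l1 : Tendsto (fun k => A ^ 2 * ((b k : ℝ) ^ 2 * Real.exp (-(v ^ 2 / 4 * b k))))
      atTop (𝓝 0) := by
    have := (Real.tendsto_pow_mul_exp_neg_atTop_nhds_zero 2).comp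
      (hbR.const_mul_atTop (by positivity : 0 < v ^ 2 / 4))
    have := this.const_mul (A ^ 2 / (v ^ 2 / 4) ^ 2)
    rw [mul_zero] at this
    refine this.congr fun k => ?_
    simp only [Function.comp_apply]
    have : (v ^ 2 / 4) ^ 2 ≠ 0 := by positivity
    field_simp
  have l2 : Tendsto (fun k => A ^ 2 * ((b k : ℝ))⁻¹) atTop (𝓝 0) := by
    simpa using (tendsto_inv_atTop_zero.comp hbR).const_mul (A ^ 2)
  have l3 := l1.add l2
  rw [add_zero] at l3
  refine squeeze_zero' (Eventually.of_forall fun k => by positivity) ?_ l3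
  filter_upwards [hA, ht, hb.eventually_ge_atTop 1] with k h1 h2 h3
  have hb0 : (0 : ℝ) < b k := by exact_mod_cast h3
  have h4 : (a k : ℝ) ^ 2 ≤ A ^ 2 * (b k : ℝ) ^ 2 := by
    rw [← mul_pow]
    exact pow_le_pow_left₀ (Nat.cast_nonneg _) h1 2
  have h5 : Real.exp (-(t k * η ^ 2 / 4)) ≤ ((b k : ℝ) ^ 3)⁻¹ := by
    rw [Real.exp_neg]
    refine inv_anti₀ (by positivity) ?_
    rw [← Real.log_le_iff_le_exp (by positivity), Real.log_pow]
    have := mul_le_mul_of_nonneg_right h2 (sq_nonneg η)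
    have : C * Real.log (b k) * η ^ 2 = 12 * Real.log (b k) := by rw [← hC]; ring
    push_cast
    linarith
  calc _ ≤ A ^ 2 * (b k : ℝ) ^ 2 * (Real.exp (-(b k * v ^ 2 / 4)) + ((b k : ℝ) ^ 3)⁻¹) :=
        mul_le_mul h4 (by gcongr) (by positivity) (by positivity)
    _ = _ := by
      rw [show (b k : ℝ) * v ^ 2 / 4 = v ^ 2 / 4 * b k by ring]
      field_simp

/-- Each of the mn/N terms is at most 1/(mn), so their sum is at most 1/N < I/L. The factor 1/N is
why no margin above the threshold is needed. -/
theorem tendsto_block_error {p ε : ℝ} (hp2 : p < 1 / 2) (hε : 0 ≤ ε)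
    (hε1 : ε < 1) {M : ℕ → BlockModel}
    (hM : Tendsto (fun k => (M k).m * (M k).n) atTop atTop)
    (h : ∀ᶠ k in atTop, Real.log ((M k).m * (M k).n) / Real.log (1 / p1 p ε) <
      ((M k).m₀ * (M k).n₀ : ℝ)) :
    Tendsto (fun k => ((M k).r * (M k).t * p1 p ε ^ ((M k).m₀ * (M k).n₀) : ℝ)) atTop (𝓝 0) := by
  have hN : ∀ k, 0 < (M k).m₀ * (M k).n₀ := fun k => mul_pos (M k).m₀_pos (M k).n₀_pos
  rcases (p1_nonneg (p := p) hε hε1.le).eq_or_lt' with h0 | h0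
  · refine tendsto_const_nhds.congr fun k => ?_
    rw [h0, zero_pow (hN k).ne', mul_zero]
  set I := Real.log (1 / p1 p ε) with hI
  have hI0 : 0 < I := Real.log_pos (by rw [lt_div_iff₀ h0, one_mul]; exact p1_lt_one hp2 hε1)
  have hL : Tendsto (fun k => Real.log ((M k).m * (M k).n)) atTop atTop := by
    refine Real.tendsto_log_atTop.comp ?_
    have := (tendsto_natCast_atTop_atTop (R := ℝ)).comp hM
    refine this.congr fun k => by simp
  have l : Tendsto (fun k => I * (Real.log ((M k).m * (M k).n))⁻¹) atTop (𝓝 0) := by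
    simpa using (tendsto_inv_atTop_zero.comp hL).const_mul I
  refine squeeze_zero' (Eventually.of_forall fun k => by positivity) ?_ l
  filter_upwards [h, hL.eventually_gt_atTop 0] with k hk hk'
  set N : ℝ := (M k).m₀ * (M k).n₀ with hNdef
  have hN0 : 0 < N := by rw [hNdef]; exact_mod_cast hN k
  have hmn : ((M k).m * (M k).n : ℝ) = (M k).r * (M k).t * N := by
    rw [(M k).m_eq, (M k).n_eq, hNdef]; push_cast; ring
  have hpos : (0 : ℝ) < (M k).m * (M k).n := by
    exact_mod_cast mul_pos (M k).m_pos (M k).n_pos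
  have e1 : p1 p ε ^ ((M k).m₀ * (M k).n₀) = Real.exp (-(N * I)) := by
    rw [hI, one_div, Real.log_inv, mul_neg, neg_neg, ← Real.exp_log h0, ← Real.exp_nat_mul,
      Real.log_exp, hNdef]
    push_cast
    rfl
  have e2 : Real.exp (-(N * I)) ≤ ((M k).m * (M k).n : ℝ)⁻¹ := by
    rw [Real.exp_neg]
    refine inv_anti₀ hpos ?_
    rw [← Real.log_le_iff_le_exp hpos]
    exact ((div_lt_iff₀ hI0).1 hk).le
  have hrt : (0 : ℝ) < (M k).r * (M k).t := by
    by_contra! hneg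
    have := mul_nonpos_of_nonpos_of_nonneg hneg hN0.le
    linarith
  calc _ ≤ (M k).r * (M k).t * ((M k).m * (M k).n : ℝ)⁻¹ := by
        rw [e1]; exact mul_le_mul_of_nonneg_left e2 hrt.le
    _ = N⁻¹ := by rw [hmn, mul_inv, ← mul_assoc, mul_inv_cancel₀ hrt.ne', one_mul]
    _ ≤ (Real.log ((M k).m * (M k).n) / I)⁻¹ := inv_anti₀ (by positivity) hk.le
    _ = _ := by rw [inv_div]; rfl

theorem tendsto_avgError_clusterMajority {p₀ d₀ : ℝ} (hp₀ : 0 ≤ p₀) (hp₀2 : p₀ < 1 / 2)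
    (hd : 2 * p₀ * (1 - p₀) < d₀) (hd2 : d₀ < 1 / 2) :
    ∃ C : ℝ, 0 < C ∧ ∀ p ε : ℝ, 0 ≤ p → p ≤ p₀ → 0 ≤ ε → ε < 1 →
      ∀ M : ℕ → BlockModel,
        Tendsto (fun k => (M k).m * (M k).n) atTop atTop →
        (∀ᶠ k in atTop, C * Real.log (M k).n ≤ ((M k).t : ℝ)) →
        (∀ᶠ k in atTop, C * Real.log (M k).m ≤ ((M k).r : ℝ)) →
        limsup (fun k => ((M k).m : ℝ≥0∞) / ((M k).n : ℝ≥0∞)) atTop < ⊤ →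
        limsup (fun k => ((M k).n : ℝ≥0∞) / ((M k).m : ℝ≥0∞)) atTop < ⊤ →
        (∀ᶠ k in atTop, Real.log ((M k).m * (M k).n) / Real.log (1 / p1 p ε) <
          ((M k).m₀ * (M k).n₀ : ℝ)) →
        ∀ κ : (k : ℕ) → PMF (Fin (M k).m → Fin (M k).n → Bool),
          Tendsto (fun k => (M k).avgError p ε (clusterMajorityEstimator d₀ (κ k)))
            atTop (𝓝 0) := by
  -- Half of the gap below 1/2 is spent on the deviation of the cluster values; the other half is
  -- left for the channel.
  set η := (1 / 2 - d₀) / 2 with hη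
  have hη0 : 0 < η := by rw [hη]; linarith
  have hd0 : 0 < d₀ := lt_of_le_of_lt (by nlinarith) hd
  -- C does not involve ε: the erasures enter only through v, which is weighed against n and m
  -- rather than against their logarithms.
  refine ⟨12 / η ^ 2, by positivity, ?_⟩
  intro p ε hp hpp hε hε1 M hM ht hr hmn hnm hN κ
  set w := min (d₀ - 2 * p₀ * (1 - p₀)) η with hw
  have hw0 : 0 < w := lt_min (by linarith) hη0
  have hw1 : w ≤ 1 := (min_le_right _ _).trans (by rw [hη]; linarith)
  set v := (1 - ε) ^ 2 * w with hv
  have hε' : 0 < 1 - ε := by linarith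
  have hv0 : 0 < v := by positivity
  have hsq : (1 - ε) ^ 2 ≤ 1 := by nlinarith
  have hv2 : v ≤ 2 := by nlinarith
  have hva : v ≤ (1 - ε) ^ 2 * (d₀ - 2 * p * (1 - p)) := by
    refine mul_le_mul_of_nonneg_left ((min_le_left _ _).trans ?_) (sq_nonneg _)
    nlinarith
  have hvb : v ≤ (1 - ε) ^ 2 * (1 / 2 - η - d₀) := by
    refine mul_le_mul_of_nonneg_left ((min_le_right _ _).trans ?_) (sq_nonneg _)
    rw [hη]; linarith
  obtain ⟨A, hA0, hA⟩ := eventually_le_mul_of_limsup_div_lt_top (fun k => (M k).n_pos) hmn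
  obtain ⟨B, hB0, hB⟩ := eventually_le_mul_of_limsup_div_lt_top (fun k => (M k).m_pos) hnm
  have hn := tendsto_atTop_of_mul_of_le hM hA
  have hm := tendsto_atTop_of_mul_of_le (hM.congr fun k => mul_comm _ _) hB
  have hC : 12 / η ^ 2 * η ^ 2 = 12 := by field_simp
  have l := ((tendsto_sq_mul_exp_add_exp hA0 hn hA ht hv0 hC).add
    (tendsto_sq_mul_exp_add_exp hB0 hm hB hr hv0 hC)).add
    (tendsto_block_error (p := p) (by linarith) hε hε1 hM hN)
  simp only [add_zero] at l
  refine squeeze_zero (fun k => ?_) (fun k => ?_) l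
  · refine Finset.sum_nonneg fun w _ => mul_nonneg (by positivity) (Finset.sum_nonneg fun y _ =>
      mul_nonneg (obsProb_nonneg hp (by linarith) hε hε1.le _ _)
        (Finset.sum_nonneg fun _ _ => ENNReal.toReal_nonneg))
  · exact (M k).avgError_clusterMajority_le hp (by linarith) hε hε1.le hd0 (by linarith) hη0.le
      (by rw [hη]; linarith) hv0.le hv2 hva hvb (κ k)
/-! ### Converse -/

/-- Distinct fibres of f involve disjoint sets of coordinates, so they may be summed separately. -/
theorem sum_prod_fiber {ι γ O : Type*} [Fintype ι] [Fintype γ] [Fintype O] [DecidableEq ι]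
    [DecidableEq γ] (f : ι → γ) (F : (c : γ) → ({e // f e = c} → O) → ℝ) :
    ∑ y : ι → O, ∏ c, F c (fun e => y e) = ∏ c, ∑ z, F c z := by
  rw [Fintype.prod_sum]
  refine Fintype.sum_equiv (((Equiv.sigmaFiberEquiv f).symm.arrowCongr (Equiv.refl O)).trans
    (Equiv.piCurry fun _ _ => O)) _ _ fun y => ?_
  rfl

/-! ### Overlap of the two output laws of one cluster -/

section Testing

variable {p ε : ℝ} (T : Type*) [Fintype T] [DecidableEq T]

/-- A random walk with centred steps of size at most one has second moment at most its length. -/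
theorem sum_prod_mul_sq_le (w : Option Bool → ℝ) (hw0 : ∀ o, 0 ≤ w o) (hw : ∑ o, w o = 1)
    (s : Option Bool → ℝ) (hs : ∀ o, |s o| ≤ 1) (hws : ∑ o, w o * s o = 0) :
    ∑ z : T → Option Bool, (∏ e, w (z e)) * (∑ e, s (z e)) ^ 2 ≤ Fintype.card T := by
  have h1 : ∀ z : T → Option Bool, (∏ e, w (z e)) * (∑ e, s (z e)) ^ 2 =
      ∑ e, ∑ e', (∏ e, w (z e)) * (s (z e) * s (z e')) := by
    intro z
    rw [sq, Finset.sum_mul_sum, Finset.mul_sum]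
    exact Finset.sum_congr rfl fun e _ => Finset.mul_sum _ _ _
  -- Independent centred steps are uncorrelated, so only the diagonal contributes.
  have h2 : ∀ e e' : T, ∑ z : T → Option Bool, (∏ e, w (z e)) * (s (z e) * s (z e')) ≤
      if e = e' then 1 else 0 := by
    intro e e'
    split_ifs with h
    · subst h
      calc _ ≤ ∑ z : T → Option Bool, ∏ e, w (z e) := by
            refine Finset.sum_le_sum fun z _ => mul_le_of_le_one_right
              (Finset.prod_nonneg fun e _ => hw0 _) ?_
            rw [← abs_mul_abs_self]
            exact mul_le_one₀ (hs _) (abs_nonneg _) (hs _)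
        _ = 1 := by rw [← Fintype.prod_sum]; simp only [hw, Finset.prod_const_one]
    · rw [sum_prod_pair h (fun _ => w) (fun _ => hw) (fun a b => s a * s b)]
      have : ∀ a b, w a * w b * (s a * s b) = w a * s a * (w b * s b) := fun a b => by ring
      simp only [this, ← Finset.mul_sum, hws, mul_zero]
      simp
  simp only [h1]
  rw [Finset.sum_comm]
  calc _ = ∑ e : T, ∑ e' : T, ∑ z : T → Option Bool, (∏ e, w (z e)) * (s (z e) * s (z e')) :=
        Finset.sum_congr rfl fun e _ => Finset.sum_comm
    _ ≤ ∑ e : T, ∑ e' : T, (if e = e' then 1 else 0) :=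
        Finset.sum_le_sum fun e _ => Finset.sum_le_sum fun e' _ => h2 e e'
    _ = _ := by simp

/-- The overlap of the two laws of the observations of a cluster decays at most like
`p₁ ^ N * exp (- b √N)`. -/
theorem exists_le_sum_min (hp : 0 ≤ p) (hp2 : p < 1 / 2) (hε : 0 ≤ ε) (hε1 : ε < 1) :
    ∃ b : ℝ, 0 ≤ b ∧ ∀ (T : Type) [Fintype T] [DecidableEq T] [Nonempty T],
      p1 p ε ^ Fintype.card T * Real.exp (-(b * √(Fintype.card T))) ≤
        ∑ z : T → Option Bool,
          min (∏ e, cascade p ε true (z e)) (∏ e, cascade p ε false (z e)) := by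
  classical
  have hc := fun x o => cascade_nonneg hp (by linarith : p ≤ 1) hε hε1.le x o
  rcases hp.eq_or_lt with rfl | hp0
  -- For p = 0 the log-likelihood ratio is infinite, but p₁ = ε and the all-erased outcome alone
  -- gives the bound with b = 0.
  · refine ⟨0, le_rfl, fun T _ _ _ => ?_⟩
    have hmin : ∀ z : T → Option Bool, 0 ≤
        min (∏ e, cascade 0 ε true (z e)) (∏ e, cascade 0 ε false (z e)) := fun z =>
      le_min (Finset.prod_nonneg fun _ _ => hc _ _) (Finset.prod_nonneg fun _ _ => hc _ _)
    refine le_trans (le_of_eq ?_) (Finset.single_le_sum (fun z _ => hmin z)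
      (Finset.mem_univ fun _ => none))
    simp [cascade_none, p1]
  -- Half of the log-likelihood ratio of an unerased symbol: each output law is the geometric mean u
  -- tilted by exp(±h s).
  set h := Real.log ((1 - p) / p) / 2 with hh
  have hh0 : 0 ≤ h := by
    refine div_nonneg (Real.log_nonneg ?_) (by norm_num)
    rw [le_div_iff₀ hp0]; linarith
  have hq : 0 < p1 p ε := by
    have : 0 < √(p * (1 - p)) := Real.sqrt_pos.2 (mul_pos hp0 (by linarith))
    have : 0 < 1 - ε := by linarith
    unfold p1
    positivity
  refine ⟨h, hh0, fun T _ _ _ => ?_⟩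
  let u : Option Bool → ℝ := fun o => √(cascade p ε true o * cascade p ε false o)
  let s : Option Bool → ℝ := fun o => match o with
    | none => 0
    | some true => 1
    | some false => -1
  have hu : ∑ o, u o = p1 p ε := sum_sqrt_cascade hε hε1.le true
  have huv : ∀ o, cascade p ε true o = u o * Real.exp (h * s o) ∧
      cascade p ε false o = u o * Real.exp (-(h * s o)) := by
    have e1 : Real.exp h = √((1 - p) / p) := by
      rw [hh, ← Real.log_sqrt (by have : 0 < 1 - p := by linarith
                                  positivity), Real.exp_log (Real.sqrt_pos.2
        (div_pos (by linarith) hp0))]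
    have e2 : Real.exp (-h) = √(p / (1 - p)) := by
      rw [Real.exp_neg, e1, ← Real.sqrt_inv, inv_div]
    have hp1 : 0 < 1 - p := by linarith
    have hε0 : 0 ≤ 1 - ε := by linarith
    have aux : ∀ a b : ℝ, 0 < a → 0 < b →
        √((1 - ε) * a * ((1 - ε) * b)) * √(a / b) = (1 - ε) * a := by
      intro a b ha hb
      rw [← Real.sqrt_mul (by positivity)]
      rw [show (1 - ε) * a * ((1 - ε) * b) * (a / b) = ((1 - ε) * a) ^ 2 by field_simp]
      exact Real.sqrt_sq (by positivity)
    intro o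
    rcases o with _ | _ | _
    · simp [u, s, cascade_none, Real.sqrt_mul_self hε]
    · simp only [u, s, cascade_some, mul_neg, mul_one, neg_neg, e1, e2, if_true]
      simp only [Bool.false_eq_true, if_false]
      rw [aux p (1 - p) hp0 hp1, mul_comm ((1 - ε) * p), aux (1 - p) p hp1 hp0]
      exact ⟨rfl, rfl⟩
    · simp only [u, s, cascade_some, mul_one, e1, e2, if_true]
      simp only [Bool.true_eq_false, if_false]
      rw [aux (1 - p) p hp1 hp0, mul_comm ((1 - ε) * (1 - p)), aux p (1 - p) hp0 hp1]
      exact ⟨rfl, rfl⟩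
  have hmin : ∀ z : T → Option Bool,
      min (∏ e, cascade p ε true (z e)) (∏ e, cascade p ε false (z e)) =
        (∏ e, u (z e)) * Real.exp (-(h * |∑ e, s (z e)|)) := by
    intro z
    simp only [(huv _).1, (huv _).2, Finset.prod_mul_distrib, ← Real.exp_sum,
      Finset.sum_neg_distrib, ← Finset.mul_sum]
    rw [← mul_min_of_nonneg _ _ (Finset.prod_nonneg fun e _ => Real.sqrt_nonneg _),
      ← Real.exp_monotone.map_min]
    congr 2
    rcases le_total 0 (∑ e, s (z e)) with h0 | h0
    · rw [abs_of_nonneg h0, min_eq_right]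
      have := mul_nonneg hh0 h0
      linarith
    · rw [abs_of_nonpos h0, min_eq_left, mul_neg, neg_neg]
      have := mul_nonpos_of_nonneg_of_nonpos hh0 h0
      linarith
  simp only [hmin]
  set N : ℝ := (Fintype.card T : ℝ) with hN
  have hN0 : 0 < N := by rw [hN]; exact_mod_cast Fintype.card_pos
  have hr0 : 0 < √N := Real.sqrt_pos.2 hN0
  have hrr : √N * √N = N := Real.mul_self_sqrt hN0.le
  -- Normalising u by its total p₁ produces the factor p₁^N and a probability law that is symmetric
  -- in the two symbols, hence centred for s.
  set w : Option Bool → ℝ := fun o => u o / p1 p ε with hw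
  have hw1 : ∑ o, w o = 1 := by
    rw [hw, ← Finset.sum_div, hu, div_self hq.ne']
  have hw0 : ∀ o, 0 ≤ w o := fun o => div_nonneg (Real.sqrt_nonneg _) hq.le
  have hss : ∀ o, |s o| ≤ 1 := by
    intro o
    rcases o with _ | _ | _ <;> simp [s]
  have hws : ∑ o, w o * s o = 0 := by
    rw [Fintype.sum_option, Fintype.sum_bool]
    have : w (some true) = w (some false) := by
      simp only [hw, u, cascade_some]
      simp [mul_comm]
    simp [s, this]
  have hsq := sum_prod_mul_sq_le T w hw0 hw1 s hss hws
  have hW1 : ∑ z : T → Option Bool, ∏ e, w (z e) = 1 := by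
    rw [← Fintype.prod_sum]; simp only [hw1, Finset.prod_const_one]
  have hUW : ∀ z : T → Option Bool, ∏ e, u (z e) = p1 p ε ^ Fintype.card T * ∏ e, w (z e) := by
    intro z
    rw [hw, Finset.prod_div_distrib, Finset.prod_const, Finset.card_univ]
    field_simp
  simp only [hUW, mul_assoc, ← Finset.mul_sum]
  refine mul_le_mul_of_nonneg_left ?_ (pow_pos hq _).le
  -- A lower bound that is affine in S², so that the second moment E S² ≤ N is all that is needed.
  -- It combines exp x ≥ 1 + x at x = h√N - hS with S ≤ (S²/√N + √N)/2.
  have hpt : ∀ z : T → Option Bool, Real.exp (-(h * √N)) * ((∏ e, w (z e)) * (1 + h * √N / 2) -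
      h / (2 * √N) * ((∏ e, w (z e)) * (∑ e, s (z e)) ^ 2)) ≤
      (∏ e, w (z e)) * Real.exp (-(h * |∑ e, s (z e)|)) := by
    intro z
    have hW : 0 ≤ ∏ e, w (z e) := Finset.prod_nonneg fun _ _ => hw0 _
    set S := |∑ e, s (z e)| with hS
    rw [← sq_abs (∑ e, s (z e)), ← hS]
    have h1 : -(h * S) = -(h * √N) + (h * √N - h * S) := by ring
    have h2 : S ≤ (S ^ 2 / √N + √N) / 2 := by
      rw [le_div_iff₀ (by norm_num), div_add' _ _ _ hr0.ne', le_div_iff₀ hr0]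
      nlinarith [sq_nonneg (S - √N)]
    have h3 : 1 + h * √N / 2 - h / (2 * √N) * S ^ 2 ≤ Real.exp (h * √N - h * S) := by
      refine le_trans ?_ (Real.add_one_le_exp _)
      have := mul_le_mul_of_nonneg_left h2 hh0
      have e : h * ((S ^ 2 / √N + √N) / 2) = h / (2 * √N) * S ^ 2 + h * √N / 2 := by
        field_simp
      linarith
    rw [h1, Real.exp_add]
    calc _ = Real.exp (-(h * √N)) * (∏ e, w (z e)) *
          (1 + h * √N / 2 - h / (2 * √N) * S ^ 2) := by ring
      _ ≤ Real.exp (-(h * √N)) * (∏ e, w (z e)) * Real.exp (h * √N - h * S) :=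
          mul_le_mul_of_nonneg_left h3 (by positivity)
      _ = _ := by ring
  refine le_trans ?_ (Finset.sum_le_sum fun z _ => hpt z)
  rw [← Finset.mul_sum, Finset.sum_sub_distrib, ← Finset.sum_mul, hW1, ← Finset.mul_sum]
  refine le_mul_of_one_le_right (Real.exp_pos _).le ?_
  have h4 := mul_le_mul_of_nonneg_left hsq (by positivity : 0 ≤ h / (2 * √N))
  have h5 : h / (2 * √N) * N = h * √N / 2 := by
    rw [div_mul_eq_mul_div, div_eq_div_iff (by positivity) (by norm_num)]
    linear_combination (-2 * h) * hrr
  rw [← hN, h5] at h4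
  linarith

end Testing

/-! ### Success probability of an arbitrary estimator -/

namespace BlockModel

variable (M : BlockModel) {p ε : ℝ}

theorem expand_injective : Function.Injective M.expand := by
  intro w w' h
  funext a b
  obtain ⟨i, hi⟩ := Finset.card_pos.1 (lt_of_lt_of_eq M.m₀_pos (M.card_row a).symm)
  obtain ⟨k, hk⟩ := Finset.card_pos.1 (lt_of_lt_of_eq M.n₀_pos (M.card_col b).symm)
  have := congrFun (congrFun h i) k
  simp only [Finset.mem_filter, Finset.mem_univ, true_and] at hi hk
  rwa [expand, expand, hi, hk] at this

/-- The cluster of an entry. -/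
def cell (e : Fin M.m × Fin M.n) : Fin M.r × Fin M.t := (M.row e.1, M.col e.2)

theorem card_cell (c : Fin M.r × Fin M.t) :
    Fintype.card {e // M.cell e = c} = M.m₀ * M.n₀ := by
  rw [← M.card_block c.1 c.2, Fintype.card_subtype]
  congr 1
  ext e
  simp [cell, block, Prod.ext_iff]

theorem obsProb_expand (w : Fin M.r → Fin M.t → Bool) (y : Observations M.m M.n) :
    obsProb p ε (M.expand w) y = ∏ c, ∏ e : {e // M.cell e = c},
      cascade p ε (w c.1 c.2) (y e.1.1 e.1.2) := by
  rw [obsProb, ← Fintype.prod_prod_type', ← Fintype.prod_fiberwise M.cell]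
  refine Finset.prod_congr rfl fun c _ => Finset.prod_congr rfl fun e _ => ?_
  rw [expand, show M.row e.1.1 = c.1 from congrArg Prod.fst e.2,
    show M.col e.1.2 = c.2 from congrArg Prod.snd e.2]

theorem avgError_le_one (hp : 0 ≤ p) (hp1 : p ≤ 1) (hε : 0 ≤ ε) (hε1 : ε ≤ 1)
    (g : Estimator M.m M.n) : M.avgError p ε g ≤ 1 := by
  rw [← M.sum_uniform]
  refine Finset.sum_le_sum fun w _ => mul_le_of_le_one_right (by positivity) ?_
  rw [← sum_obsProb (p := p) (ε := ε) (M.expand w)]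
  refine Finset.sum_le_sum fun y _ =>
    mul_le_of_le_one_right (obsProb_nonneg hp hp1 hε hε1 _ _) ?_
  rw [← PMF.sum_toReal (g y)]
  exact Finset.sum_le_sum_of_subset_of_nonneg (Finset.filter_subset _ _)
    fun _ _ _ => ENNReal.toReal_nonneg

/-- Given y, the probabilities of guessing the various w sum to at most one, since distinct w have
distinct expansions. Thus the likelihood may be replaced by its maximum over w, which factorises
over the clusters. -/
theorem one_sub_avgError_le (hp : 0 ≤ p) (hp1 : p ≤ 1) (hε : 0 ≤ ε) (hε1 : ε ≤ 1)
    (g : Estimator M.m M.n) :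
    1 - M.avgError p ε g ≤ (1 / 2 : ℝ) ^ (M.r * M.t) * ∏ c, ∑ z : {e // M.cell e = c} → Option Bool,
      max (∏ e, cascade p ε true (z e)) (∏ e, cascade p ε false (z e)) := by
  classical
  have hc := fun x o => cascade_nonneg hp hp1 hε hε1 x o
  let A (y : Observations M.m M.n) : ℝ := ∏ c, max
    (∏ e : {e // M.cell e = c}, cascade p ε true (y e.1.1 e.1.2))
    (∏ e : {e // M.cell e = c}, cascade p ε false (y e.1.1 e.1.2))
  have hA0 : ∀ y, 0 ≤ A y := fun y => Finset.prod_nonneg fun c _ =>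
    le_max_of_le_left (Finset.prod_nonneg fun _ _ => hc _ _)
  have hA : ∀ w y, obsProb p ε (M.expand w) y ≤ A y := by
    intro w y
    rw [obsProb_expand]
    refine Finset.prod_le_prod (fun c _ => Finset.prod_nonneg fun _ _ => hc _ _) fun c _ => ?_
    cases w c.1 c.2
    exacts [le_max_right _ _, le_max_left _ _]
  have h1 : 1 - M.avgError p ε g = (1 / 2 : ℝ) ^ (M.r * M.t) *
      ∑ y, ∑ w, obsProb p ε (M.expand w) y * (g y (M.expand w)).toReal := by
    have : ∀ y w, ∑ x' ∈ Finset.univ.filter (fun x' : Ratings M.m M.n => x' ≠ M.expand w),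
        (g y x').toReal = 1 - (g y (M.expand w)).toReal := by
      intro y w
      rw [← PMF.sum_toReal (g y), Finset.filter_ne', ← Finset.sum_erase_eq_sub (Finset.mem_univ _)]
    simp only [avgError, this, mul_sub, mul_one, Finset.sum_sub_distrib, sum_obsProb]
    rw [sum_uniform, sub_sub_cancel, ← Finset.mul_sum, Finset.sum_comm]
  have h2 : ∀ y, ∑ w, (g y (M.expand w)).toReal ≤ 1 := by
    intro y
    rw [← PMF.sum_toReal (g y), ← Finset.sum_image (f := fun x => (g y x).toReal)
      (M.expand_injective.injOn)]
    exact Finset.sum_le_sum_of_subset_of_nonneg (Finset.subset_univ _)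
      fun _ _ _ => ENNReal.toReal_nonneg
  rw [h1]
  refine mul_le_mul_of_nonneg_left ?_ (by positivity)
  calc _ ≤ ∑ y, A y := by
        refine Finset.sum_le_sum fun y _ => ?_
        calc _ ≤ ∑ w, A y * (g y (M.expand w)).toReal := Finset.sum_le_sum fun w _ =>
              mul_le_mul_of_nonneg_right (hA w y) ENNReal.toReal_nonneg
          _ ≤ A y := by
              rw [← Finset.mul_sum]
              exact mul_le_of_le_one_right (hA0 y) (h2 y)
    _ = _ := by
        rw [← sum_prod_fiber M.cell (fun c (z : {e // M.cell e = c} → Option Bool) =>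
          max (∏ e, cascade p ε true (z e)) (∏ e, cascade p ε false (z e)))]
        exact Fintype.sum_equiv (Equiv.curry _ _ _).symm _ _ fun y => rfl

/-- Since max + min is the sum of two probabilities, each factor is at most 1 - q/2 ≤ exp(-q/2). -/
theorem one_sub_avgError_le_exp (hp : 0 ≤ p) (hp1 : p ≤ 1) (hε : 0 ≤ ε) (hε1 : ε ≤ 1) {q : ℝ}
    (hq : ∀ c, q ≤ ∑ z : {e // M.cell e = c} → Option Bool,
      min (∏ e, cascade p ε true (z e)) (∏ e, cascade p ε false (z e)))
    (g : Estimator M.m M.n) :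
    1 - M.avgError p ε g ≤ Real.exp (-(q / 2 * (M.r * M.t))) := by
  refine (M.one_sub_avgError_le hp hp1 hε hε1 g).trans ?_
  have hK : (1 / 2 : ℝ) ^ (M.r * M.t) = ∏ _c : Fin M.r × Fin M.t, (1 / 2 : ℝ) := by simp
  rw [hK, ← Finset.prod_mul_distrib]
  have h1 : ∀ (x : Bool) (c : Fin M.r × Fin M.t), ∑ z : {e // M.cell e = c} → Option Bool,
      ∏ e, cascade p ε x (z e) = 1 := by
    intro x c
    rw [← Fintype.prod_sum (fun (_ : {e // M.cell e = c}) o => cascade p ε x o)]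
    simp only [sum_cascade, Finset.prod_const_one]
  calc _ ≤ ∏ _c : Fin M.r × Fin M.t, Real.exp (-(q / 2)) := by
        refine Finset.prod_le_prod (fun c _ => mul_nonneg (by norm_num)
          (Finset.sum_nonneg fun z _ => le_max_of_le_left
            (Finset.prod_nonneg fun _ _ => cascade_nonneg hp hp1 hε hε1 _ _))) fun c _ => ?_
        refine le_trans ?_ (Real.add_one_le_exp _)
        have := hq c
        have h2 := h1 true c
        have h3 := h1 false c
        have h4 : ∑ z : {e // M.cell e = c} → Option Bool,
            max (∏ e, cascade p ε true (z e)) (∏ e, cascade p ε false (z e)) +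
            ∑ z : {e // M.cell e = c} → Option Bool,
            min (∏ e, cascade p ε true (z e)) (∏ e, cascade p ε false (z e)) = 2 := by
          rw [← Finset.sum_add_distrib]
          simp only [max_add_min, Finset.sum_add_distrib, h2, h3]
          norm_num
        linarith
    _ = _ := by
        rw [Finset.prod_const, ← Real.exp_nat_mul]
        congr 1
        simp
        ring

end BlockModel

theorem tendsto_avgError_one {p ε δ : ℝ} (hp : 0 ≤ p) (hp2 : p < 1 / 2) (hε : 0 ≤ ε)
    (hε1 : ε < 1) (hδ : 0 < δ) {M : ℕ → BlockModel}
    (hM : Tendsto (fun k => (M k).m * (M k).n) atTop atTop)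
    (h : ∀ᶠ k in atTop, ((M k).m₀ * (M k).n₀ : ℝ) <
      (1 - δ) * (Real.log ((M k).m * (M k).n) / Real.log (1 / p1 p ε)))
    (g : (k : ℕ) → Estimator (M k).m (M k).n) :
    Tendsto (fun k => (M k).avgError p ε (g k)) atTop (𝓝 1) := by
  have hp1 : p ≤ 1 := by linarith
  -- If p₁ = 0, the conventions for division and logarithm at zero make the threshold 0, and no
  -- cluster size lies below it.
  rcases (p1_nonneg (p := p) hε hε1.le).eq_or_lt' with h0 | h0
  · obtain ⟨k, hk⟩ := h.exists
    rw [h0] at hk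
    simp only [div_zero, Real.log_zero, mul_zero] at hk
    have : (0 : ℝ) ≤ (M k).m₀ * (M k).n₀ := by positivity
    linarith
  set I := Real.log (1 / p1 p ε) with hI
  have hI0 : 0 < I := Real.log_pos (by rw [lt_div_iff₀ h0, one_mul]; exact p1_lt_one hp2 hε1)
  obtain ⟨b, hb0, hb⟩ := exists_le_sum_min hp hp2 hε hε1
  let L (k : ℕ) : ℝ := Real.log ((M k).m * (M k).n)
  have hL : Tendsto L atTop atTop := by
    refine Real.tendsto_log_atTop.comp ?_
    have := (tendsto_natCast_atTop_atTop (R := ℝ)).comp hM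
    refine this.congr fun k => by simp
  set A := I * δ / 4 * Real.exp (-(b ^ 2 / (2 * δ * I))) with hA
  have hA0 : 0 < A := by positivity
  have hG : Tendsto (fun k => A * (Real.exp (δ / 2 * L k) / (δ / 2 * L k))) atTop atTop := by
    refine Tendsto.const_mul_atTop hA0 ?_
    have := (Real.tendsto_exp_div_pow_atTop 1).comp
      (hL.const_mul_atTop (by positivity : 0 < δ / 2))
    simpa [Function.comp_def] using this
  have hE : Tendsto (fun k => 1 - Real.exp (-(A * (Real.exp (δ / 2 * L k) / (δ / 2 * L k)))))
      atTop (𝓝 1) := by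
    simpa using (Real.tendsto_exp_neg_atTop_nhds_zero.comp hG).const_sub 1
  refine tendsto_of_tendsto_of_tendsto_of_le_of_le' hE tendsto_const_nhds ?_ ?_
  · filter_upwards [h, hL.eventually_gt_atTop 0] with k hk hLk
    set N : ℝ := (M k).m₀ * (M k).n₀ with hN
    have hN0 : 0 < N := by
      rw [hN]; exact_mod_cast mul_pos (M k).m₀_pos (M k).n₀_pos
    change N < (1 - δ) * (L k / I) at hk
    have hNI : N * I < (1 - δ) * L k := by
      rw [← mul_div_assoc, lt_div_iff₀ hI0] at hk
      exact hk
    have hq := (M k).one_sub_avgError_le_exp hp hp1 hε hε1.le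
      (q := p1 p ε ^ ((M k).m₀ * (M k).n₀) * Real.exp (-(b * √N))) (fun c => ?_) (g k)
    · suffices A * (Real.exp (δ / 2 * L k) / (δ / 2 * L k)) ≤
          p1 p ε ^ ((M k).m₀ * (M k).n₀) * Real.exp (-(b * √N)) / 2 * ((M k).r * (M k).t) by
        have := Real.exp_le_exp.2 (neg_le_neg this)
        linarith
      have hpos : (0 : ℝ) < (M k).m * (M k).n := by
        exact_mod_cast mul_pos (M k).m_pos (M k).n_pos
      have hmn : ((M k).m * (M k).n : ℝ) = (M k).r * (M k).t * N := by
        rw [(M k).m_eq, (M k).n_eq, hN]; push_cast; ring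
      have hrt : ((M k).r * (M k).t : ℝ) = Real.exp (L k) / N := by
        rw [Real.exp_log hpos, hmn, mul_div_cancel_right₀ _ hN0.ne']
      have e1 : p1 p ε ^ ((M k).m₀ * (M k).n₀) = Real.exp (-(N * I)) := by
        rw [hI, one_div, Real.log_inv, mul_neg, neg_neg, ← Real.exp_log h0, ← Real.exp_nat_mul,
          Real.log_exp, hN]
        push_cast
        rfl
      have hNL : N * I ≤ L k := by nlinarith
      -- Completing the square, with NI ≤ L: the correction b√N uses up half of the margin δL, at
      -- the price of the constant that appears in A.
      have e2 : b * √N ≤ δ / 2 * L k + b ^ 2 / (2 * δ * I) := by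
        have h1 : √N ^ 2 = N := Real.sq_sqrt hN0.le
        have h2 : 0 ≤ (δ * I * √N - b) ^ 2 / (2 * δ * I) := by positivity
        have h3 : (δ * I * √N - b) ^ 2 / (2 * δ * I) =
            δ / 2 * (I * √N ^ 2) - b * √N + b ^ 2 / (2 * δ * I) := by
          field_simp
          ring
        rw [h1] at h3
        nlinarith [mul_le_mul_of_nonneg_left hNL (by positivity : 0 ≤ δ / 2)]
      have e3 : Real.exp (-(b ^ 2 / (2 * δ * I))) * Real.exp (δ / 2 * L k) ≤
          Real.exp (-(N * I)) * Real.exp (-(b * √N)) * Real.exp (L k) := by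
        rw [← Real.exp_add, ← Real.exp_add, ← Real.exp_add, Real.exp_le_exp]
        linarith
      have e4 : I / L k ≤ 1 / N := by
        rw [div_le_div_iff₀ hLk hN0]; linarith
      rw [e1, hrt]
      calc _ = (Real.exp (-(b ^ 2 / (2 * δ * I))) * Real.exp (δ / 2 * L k)) / 2 * (I / L k) := by
            rw [hA]; field_simp; ring
        _ ≤ (Real.exp (-(N * I)) * Real.exp (-(b * √N)) * Real.exp (L k)) / 2 * (1 / N) :=
            mul_le_mul (by linarith) e4 (by positivity) (by positivity)
        _ = _ := by ring
    · have hcard := (M k).card_cell c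
      have : Nonempty {e // (M k).cell e = c} := by
        rw [← Fintype.card_pos_iff, hcard]
        exact mul_pos (M k).m₀_pos (M k).n₀_pos
      have := hb {e // (M k).cell e = c}
      rw [hcard] at this
      rw [hN]
      exact_mod_cast this
  · exact Eventually.of_forall fun k => (M k).avgError_le_one hp hp1 hε hε1.le (g k)

theorem mainTheorem1 :
    -- Converse
    (∀ p₀ p ε δ : ℝ, p₀ < 1 / 2 → 0 ≤ p → p ≤ p₀ → 0 ≤ ε → ε < 1 → 0 < δ →
      ∀ M : ℕ → BlockModel,
        Tendsto (fun k => (M k).m * (M k).n) atTop atTop →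
        (∀ᶠ k in atTop, ((M k).m₀ * (M k).n₀ : ℝ) <
          (1 - δ) * (Real.log ((M k).m * (M k).n) / Real.log (1 / p1 p ε))) →
        ∀ g : (k : ℕ) → Estimator (M k).m (M k).n,
          Tendsto (fun k => (M k).avgError p ε (g k)) atTop (𝓝 1)) ∧
    -- Achievability
    (∃ (P : RamProg) (q : Polynomial ℕ), ∀ p₀ d₀ : ℝ, 0 ≤ p₀ → p₀ < 1 / 2 →
      2 * p₀ * (1 - p₀) < d₀ → d₀ < 1 / 2 →
      RunsWithin d₀ P q ∧
      ∃ C : ℝ, 0 < C ∧ ∀ p ε : ℝ, 0 ≤ p → p ≤ p₀ → 0 ≤ ε → ε < 1 →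
        ∀ M : ℕ → BlockModel,
          Tendsto (fun k => (M k).m * (M k).n) atTop atTop →
          (∀ᶠ k in atTop, C * Real.log (M k).n ≤ ((M k).t : ℝ)) →
          (∀ᶠ k in atTop, C * Real.log (M k).m ≤ ((M k).r : ℝ)) →
          limsup (fun k => ((M k).m : ℝ≥0∞) / ((M k).n : ℝ≥0∞)) atTop < ⊤ →
          limsup (fun k => ((M k).n : ℝ≥0∞) / ((M k).m : ℝ≥0∞)) atTop < ⊤ →
          (∀ᶠ k in atTop, Real.log ((M k).m * (M k).n) / Real.log (1 / p1 p ε) <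
            ((M k).m₀ * (M k).n₀ : ℝ)) →
          ∀ κ : (k : ℕ) → PMF (Fin (M k).m → Fin (M k).n → Bool),
            Tendsto (fun k => (M k).avgError p ε (clusterMajorityEstimator d₀ (κ k)))
              atTop (𝓝 0)) := by
  refine ⟨?_, RamProg.clusterMajorityProg, RamProg.clusterMajorityProg.costPoly, ?_⟩
  · intro p₀ p ε δ hp₀ hp hpp hε hε1 hδ M hM h g
    exact tendsto_avgError_one hp (hpp.trans_lt hp₀) hε hε1 hδ hM h g
  · intro p₀ d₀ hp₀ hp₀2 hd hd2
    refine ⟨RamProg.runsWithin_clusterMajorityProg (lt_of_le_of_lt ?_ hd),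
      tendsto_avgError_clusterMajority hp₀ hp₀2 hd hd2⟩
    exact mul_nonneg (by linarith) (by linarith)
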